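/- Let $\Gamma\subset\mathbb{C}$ be a lattice, and let $A$ be the area of a fundamental domain of $\Gamma$ divided by $\pi$. Let $$\sigma(z)=z\prod_{\gamma\in\Gamma\setminus\{0\}}\Bigl(1-\frac{z}{\gamma}\Bigr)\exp\Bigl(\frac{z}{\gamma}+\frac{z^2}{2\gamma^2}\Bigr),\qquad e^*_{0,2}=\lim_{s\to 2^+}\sum_{\gamma\in\Gamma\setminus\{0\}}\overline{\gamma}^{\,2}|\gamma|^{-2s},$$ and let $\theta(z)=\exp(-e^*_{0,2}z^2/2)\,\sigma(z)$ be the reduced theta function on $\mathbb{C}/\Gamma$ associated to the divisor $[0]$, normalized by $\theta'(0)=1$. For $z_0\in\mathbb{C}$ put $$\theta_{z_0}(z)=\theta(z+z_0)\exp\Bigl(-\frac{z\overline{z_0}}{A}-\frac{z_0\overline{z_0}}{2A}\Bigr).$$ Let $\Delta=g_2^3-27g_3^2$, where $g_2=60\sum_{\gamma\in\Gamma\setminus\{0\}}\gamma^{-4}$ and $g_3=140\sum_{\gamma\in\Gamma\setminus\{0\}}\gamma^{-6}$. Let $K$ be an imaginary quadratic field with a fixed embedding into $\mathbb{C}$ and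 ring of integers $\mathcal{O}_K$, and assume that $\mathcal{O}_K\Gamma\subset\Gamma$, i.e. the elliptic curve $E=\mathbb{C}/\Gamma$ has complex multiplication by $\mathcal{O}_K$. Let $N$ denote the ideal norm, with $N\alpha=N((\alpha))$. For $\alpha\in\mathcal{O}_K$, let $E[\alpha]$ be the set of points of $\mathbb{C}/\Gamma$ killed by $\alpha$. Let $\mathfrak{f}$ be a nonzero ideal of $\mathcal{O}_K$, let $\alpha\in\mathcal{O}_K$ be nonzero, and let $z_0\in\mathbb{C}$ represent an $\mathfrak{f}$-torsion point of $\mathbb{C}/\Gamma$, i.e. $\mathfrak{f}z_0\subset\Gamma$. Then $E[\alpha]$ is finite and, for every choice of a lift $z_\alpha\in\mathbb{C}$ of each point of $E[\alpha]$ and for every $z\in\mathbb{C}$, $$\theta_{\alpha z_0}(\alpha z)^{24N(\alpha\mathfrak{f})}=\Delta^{2N(\alpha\mathfrak{f})(N\alpha-1)}\prod_{z_\alpha\in E[\alpha]}\theta_{z_0+z_\alpha}(z)^{24N(\alpha\mathfrak{f})}.$$ Moreover, for every $z\in\mathbb{C}$, the right-hand side does not depend on the choice of the lift $z_0\in\mathbb{C}$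 of the $\mathfrak{f}$-torsion point, nor on the choice of the lifts $z_\alpha$. -/

import Mathlib

open scoped ComplexConjugate NumberField Topology

noncomputable section

namespace KroneckerTheta

/-- The nonzero elements of the lattice `Γ`. -/
abbrev NonzeroPeriod (L : PeriodPair) : Type := {γ : L.lattice // γ ≠ 0}

/-- `A`: the area of a fundamental domain of `Γ`, divided by `π`. -/
def areaDivPi (L : PeriodPair) : ℝ := ZLattice.covolume L.lattice / Real.pi

/-- The Weierstrass sigma function
`σ(z) = z ∏_{γ ∈ Γ ∖ {0}} (1 - z/γ) exp (z/γ + z²/(2γ²))`. -/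
def sigma (L : PeriodPair) (z : ℂ) : ℂ :=
  z * ∏' γ : NonzeroPeriod L,
    ((1 - z / (γ.1 : ℂ)) * Complex.exp (z / (γ.1 : ℂ) + z ^ 2 / (2 * (γ.1 : ℂ) ^ 2)))

/-- `e*_{0,2} = lim_{s → 2⁺} ∑_{γ ∈ Γ ∖ {0}} γ̄² |γ|^{-2s}`. -/
def eStar (L : PeriodPair) : ℂ :=
  Filter.limUnder (𝓝[>] (2 : ℝ)) fun s : ℝ =>
    ∑' γ : NonzeroPeriod L, conj (γ.1 : ℂ) ^ 2 * ((‖(γ.1 : ℂ)‖ ^ (-2 * s) : ℝ) : ℂ)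

/-- The reduced theta function `θ(z) = exp (-e*_{0,2} z² / 2) σ(z)` of the divisor `[0]` on `ℂ/Γ`,
normalized by `θ'(0) = 1`. -/
def theta (L : PeriodPair) (z : ℂ) : ℂ :=
  Complex.exp (-(eStar L) * z ^ 2 / 2) * sigma L z

/-- The translate `θ_{z₀}(z) = θ(z + z₀) exp (-z z̄₀ / A - z₀ z̄₀ / (2A))`. -/
def thetaAt (L : PeriodPair) (z₀ z : ℂ) : ℂ :=
  theta L (z + z₀) *
    Complex.exp (-(z * conj z₀) / (areaDivPi L : ℂ) - z₀ * conj z₀ / (2 * (areaDivPi L : ℂ)))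

/-- The discriminant `Δ = g₂³ - 27 g₃²` of `Γ`, with `g₂ = 60 ∑ γ⁻⁴` and `g₃ = 140 ∑ γ⁻⁶`. -/
def discr (L : PeriodPair) : ℂ := L.g₂ ^ 3 - 27 * L.g₃ ^ 2

/-- The complex torus `ℂ/Γ`. -/
abbrev Torus (L : PeriodPair) : Type := ℂ ⧸ L.lattice

/-- The points of `ℂ/Γ` killed by multiplication by `a`, where `a` is a complex number
with `aΓ ⊆ Γ`. -/
def torsionPoints (L : PeriodPair) (a : ℂ) : Set (Torus L) :=
  {P | ∃ z : ℂ, L.lattice.mkQ z = P ∧ a * z ∈ L.lattice}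

/-- `ℓ` chooses, for each `a`-torsion point of `ℂ/Γ`, a lift of that point to `ℂ`. -/
def IsLiftOfTorsion (L : PeriodPair) (a : ℂ) (ℓ : Torus L → ℂ) : Prop :=
  ∀ P ∈ torsionPoints L a, L.lattice.mkQ (ℓ P) = P

/-- `Γ` has complex multiplication by the ring of integers of `K`, embedded in `ℂ` by `ι`. -/
def HasCM {K : Type*} [Field K] (ι : K →+* ℂ) (L : PeriodPair) : Prop :=
  ∀ a : 𝓞 K, ∀ γ ∈ L.lattice, ι (a : K) * γ ∈ L.lattice

/-- `z₀` represents an `𝔣`-torsion point of `ℂ/Γ`. -/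
def IsIdealTorsion {K : Type*} [Field K] (ι : K →+* ℂ) (L : PeriodPair) (𝔣 : Ideal (𝓞 K))
    (z₀ : ℂ) : Prop :=
  ∀ a ∈ 𝔣, ι (a : K) * z₀ ∈ L.lattice

/-- The product `Δ^{2 N(α𝔣) (Nα - 1)} ∏_{z_α ∈ E[α]} θ_{z₀ + z_α}(z)^{24 N(α𝔣)}`, formed with the
representative `z₀` and with the lift `z_α = ℓ P` of each point `P` of `E[α]`. -/
def distributionProduct {K : Type*} [Field K] [NumberField K] (ι : K →+* ℂ) (L : PeriodPair)
    (𝔣 : Ideal (𝓞 K)) (α : 𝓞 K) (z₀ : ℂ) (ℓ : Torus L → ℂ) (z : ℂ) : ℂ :=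
  discr L ^ (2 * Ideal.absNorm (Ideal.span {α} * 𝔣) * (Ideal.absNorm (Ideal.span {α}) - 1)) *
    ∏ᶠ P ∈ torsionPoints L (ι (α : K)),
      thetaAt L (z₀ + ℓ P) z ^ (24 * Ideal.absNorm (Ideal.span {α} * 𝔣))

end KroneckerTheta

end

/-!
Everything is deduced from properties of the function
`normTheta L z = φ(z) = θ(z) exp (-|z|² / (2A))` and of the bicharacter
`weil L z w = E(z, w) = exp ((z w̄ - z̄ w) / (2A))`.

*Periodicity.* The Weierstrass zeta function `wzeta = σ' / σ` satisfies
`wzeta (z + ω) - wzeta z = e*₀,₂ ω + ω̄ / A` for every `ω` in a basis of `Γ`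
(`wzeta_add_generator`). To see this, consider `h_s(w) = w̄ |w|^{-2s}`, which is `1 / w` for `s = 1`.
For `s > 1` the series `∑ (h_s(z + ω + γ) - h_s(z + γ))` over `γ ∈ Γ` converges absolutely, and it
vanishes, because it telescopes on each coset of `ℤω`. Now expand its terms to first order at `γ`.
The remainders tend to `wzeta (z + ω) - wzeta z` as `s → 1⁺`, and the linear parts contribute
`-s ω ∑ γ̄² |γ|^{-2(s + 1)}`, whose limit is `-e*₀,₂ ω`, and `-(s - 1) ω̄ ∑ |γ|^{-2s}`, whose limit is
`-ω̄ / A` by counting lattice points in discs (`tendsto_sub_one_mul_tsum_norm_rpow`). Consequently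
`φ(z + γ) = ± E(z, γ) φ(z)` for `γ ∈ Γ` (`normTheta_add_lattice`), so that `|φ|` is periodic. The
function `θ_a(z)` is `exp (|z|² / (2A))` times `heisTheta L a z = E(a, z) φ(z + a)`, and for a torsion
point the latter depends on the choice of the representative `a` only up to a root of unity.

*The relation up to a constant.* If `aΓ ⊆ Γ` with `a ≠ 0`, then `E[a]` has `|a|²` elements, and in the
quotient `θ(az) / ∏ θ_{z_a}(z)` over `E[a]` the Gaussian factors cancel. It is a holomorphic function
off `a⁻¹Γ`, its absolute value is invariant under `a⁻¹Γ`, and its singularities are removable, hence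
it is a constant `κ_a` by Liouville's theorem (`exists_eq_const_of_norm_periodic`,
`IsMultiplier.exists_normTheta_mul_eq`).

*The constant.* Composing two such relations gives `κ_{ab} = κ_b κ_a^{|b|²}` up to roots of unity
(`IsDistributionConst.pow_eq_mul`). With `b = 2`, comparison of the two orders of composition gives
`κ_a³ = κ_2^{|a|² - 1}` up to roots of unity. The constant `κ_2` is found from the leading terms at the
origin: it is `2` divided by the product of the values of `φ` at the half-periods, up to a root of
unity, and the formula `℘(w) - ℘(z) = θ(z + w) θ(z - w) / (θ(z)² θ(w)²)` turns this product into the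
discriminant of the cubic `4x³ - g₂x - g₃`, with the result `κ_2⁸ = Δ²`
(`IsDistributionConst.pow_eight_eq`). Together, `κ_a^{24 |a|²} = Δ^{2 |a|² (|a|² - 1)}`
(`IsDistributionConst.pow_eq`).

The roots of unity that have been neglected are signs and values of `E` on torsion points. Their
orders are controlled by the orders of the torsion points, and the exponent `24 N(α𝔣)` kills all of
them (`thetaAt_mul_pow`, `distributionProduct_eq`). The quadratic field enters only through
`Nα = |α|²` (`absNorm_span_singleton_eq`).
-/

noncomputable section

namespace KroneckerTheta

open Filter Complex

section

variable (L : PeriodPair)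

/-! ### The sigma function -/

lemma summable_norm_rpow_lattice {r : ℝ} (hr : r < -2) :
    Summable fun γ : L.lattice => ‖(γ : ℂ)‖ ^ r :=
  ZLattice.summable_norm_rpow L.lattice r (by simpa using hr)

lemma finite_setOf_norm_lattice_lt (r : ℝ) : {γ : L.lattice | ‖(γ : ℂ)‖ < r}.Finite := by
  refine (isCompact_iff_finite.mp (isCompact_closedBall (0 : L.lattice) r)).subset fun γ hγ => ?_
  simpa using le_of_lt hγ

lemma hasSum_lattice_of_nonzero {f : L.lattice → ℂ} {a : ℂ}
    (h : HasSum (fun γ : NonzeroPeriod L => f γ.1) a) : HasSum f (f 0 + a) := by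
  have h1 := (hasSum_subtype_iff_indicator (s := {γ : L.lattice | γ ≠ 0})).1 h
  have h2 : HasSum (fun γ : L.lattice => if γ = 0 then f 0 else 0) (f 0) := hasSum_ite_eq 0 (f 0)
  convert h2.add h1 using 1
  ext γ
  by_cases hγ : γ = 0 <;> simp [hγ]

/-- The Weierstrass primary factor `E₂(u) = (1 - u) exp (u + u² / 2)`. -/
def primaryFactor (u : ℂ) : ℂ := (1 - u) * exp (u + u ^ 2 / 2)

lemma norm_primaryFactor_sub_one_le {u : ℂ} (hu : ‖u‖ ≤ 1 / 2) :
    ‖primaryFactor u - 1‖ ≤ 2 * ‖u‖ ^ 3 := by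
  have hu' : ‖-u‖ < 1 := by rw [norm_neg]; linarith
  have h1 : 1 - u ≠ 0 := by
    intro h
    have : u = 1 := by linear_combination -h
    rw [this] at hu
    norm_num at hu
  set w := log (1 + -u) - logTaylor (2 + 1) (-u) with hw
  have hE : primaryFactor u = exp w := by
    have hT : logTaylor (2 + 1) (-u) = -u - u ^ 2 / 2 := by
      simp [logTaylor_succ, logTaylor_zero]
      ring
    rw [hw, hT, ← sub_eq_add_neg, Complex.exp_sub, exp_log h1, primaryFactor,
      show -u - u ^ 2 / 2 = -(u + u ^ 2 / 2) by ring, Complex.exp_neg, div_inv_eq_mul]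
  have hwle : ‖w‖ ≤ ‖u‖ ^ 3 := by
    have h := norm_log_sub_logTaylor_le 2 hu'
    rw [norm_neg] at h
    refine h.trans ?_
    have h2 : (1 - ‖u‖)⁻¹ ≤ 2 := by
      rw [inv_le_comm₀ (by linarith) (by norm_num)]
      linarith
    have h3 : 0 ≤ ‖u‖ ^ 3 := by positivity
    norm_num
    nlinarith
  have h1' : ‖w‖ ≤ 1 := hwle.trans (pow_le_one₀ (norm_nonneg _) (by linarith))
  rw [hE]
  linarith [norm_exp_sub_one_le h1']

lemma sigma_eq_tprod (z : ℂ) :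
    sigma L z = z * ∏' γ : NonzeroPeriod L, (1 + (primaryFactor (z / (γ.1 : ℂ)) - 1)) := by
  simp only [sigma, primaryFactor, add_sub_cancel, div_pow, div_div, mul_comm]

lemma norm_primaryFactor_div_sub_one_le {r : ℝ} {z γ : ℂ} (hz : ‖z‖ < r) (hγ : 2 * r ≤ ‖γ‖) :
    ‖primaryFactor (z / γ) - 1‖ ≤ 2 * r ^ 3 * ‖γ‖ ^ (-3 : ℝ) := by
  have hr : 0 < r := (norm_nonneg z).trans_lt hz
  have hγ0 : 0 < ‖γ‖ := by linarith
  have h1 : ‖z / γ‖ ≤ r / ‖γ‖ := by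
    rw [norm_div]
    gcongr
  have h2 : r / ‖γ‖ ≤ 1 / 2 := by
    rw [div_le_iff₀ hγ0]
    linarith
  refine (norm_primaryFactor_sub_one_le (h1.trans h2)).trans ?_
  have h3 : ‖γ‖ ^ (-3 : ℝ) = (‖γ‖ ^ 3)⁻¹ := by
    rw [Real.rpow_neg (norm_nonneg _)]
    norm_cast
  rw [h3, mul_assoc, ← div_eq_mul_inv, ← div_pow]
  gcongr

lemma summable_nonzeroPeriod :
    Summable fun γ : NonzeroPeriod L => ‖(γ.1 : ℂ)‖ ^ (-3 : ℝ) :=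
  (summable_norm_rpow_lattice L (by norm_num)).comp_injective Subtype.val_injective

lemma eventually_norm_primaryFactor_le (r : ℝ) :
    ∀ᶠ γ : NonzeroPeriod L in cofinite, ∀ z ∈ Metric.ball (0 : ℂ) r,
      ‖primaryFactor (z / (γ.1 : ℂ)) - 1‖ ≤ 2 * r ^ 3 * ‖(γ.1 : ℂ)‖ ^ (-3 : ℝ) := by
  have h : ∀ᶠ γ : NonzeroPeriod L in cofinite, ¬ ‖(γ.1 : ℂ)‖ < 2 * r :=
    ((finite_setOf_norm_lattice_lt L (2 * r)).preimage
      Subtype.val_injective.injOn).eventually_cofinite_notMem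
  filter_upwards [h] with γ hγ z hz
  exact norm_primaryFactor_div_sub_one_le (by simpa using hz) (not_lt.1 hγ)

lemma multipliableLocallyUniformlyOn_primaryFactor (r : ℝ) :
    MultipliableLocallyUniformlyOn
      (fun (γ : NonzeroPeriod L) z => 1 + (primaryFactor (z / (γ.1 : ℂ)) - 1))
      (Metric.ball (0 : ℂ) r) := by
  refine Summable.multipliableLocallyUniformlyOn_one_add Metric.isOpen_ball
    ((summable_nonzeroPeriod L).mul_left (2 * r ^ 3)) (eventually_norm_primaryFactor_le L r) ?_
  intro γ
  unfold primaryFactor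
  fun_prop

lemma differentiable_tprod_primaryFactor :
    Differentiable ℂ fun z => ∏' γ : NonzeroPeriod L, (1 + (primaryFactor (z / (γ.1 : ℂ)) - 1)) := by
  intro z
  have hm : Metric.ball (0 : ℂ) (‖z‖ + 1) ∈ 𝓝 z := Metric.isOpen_ball.mem_nhds (by simp)
  refine DifferentiableOn.differentiableAt ?_ hm
  refine ((multipliableLocallyUniformlyOn_primaryFactor L
    (‖z‖ + 1)).hasProdLocallyUniformlyOn).differentiableOn (.of_forall fun s => ?_)
    Metric.isOpen_ball
  unfold primaryFactor
  fun_prop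

lemma differentiable_sigma : Differentiable ℂ (sigma L) := by
  rw [show sigma L = fun z => _ from funext (sigma_eq_tprod L)]
  exact differentiable_id.mul (differentiable_tprod_primaryFactor L)

lemma tprod_primaryFactor_ne_zero {z : ℂ} (hz : z ∉ L.lattice ∨ z = 0) :
    ∏' γ : NonzeroPeriod L, (1 + (primaryFactor (z / (γ.1 : ℂ)) - 1)) ≠ 0 := by
  refine tprod_one_add_ne_zero_of_summable (fun γ => ?_) ?_
  · have hγ : (γ.1 : ℂ) ≠ 0 := by simpa using γ.2
    simp only [primaryFactor, add_sub_cancel, ne_eq, mul_eq_zero, exp_ne_zero, or_false]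
    intro h
    have hz' : z = γ.1 := by
      field_simp at h
      linear_combination -h
    rcases hz with hz | hz
    · exact hz (hz' ▸ γ.1.2)
    · exact hγ (hz' ▸ hz)
  · refine Summable.of_norm_bounded_eventually
      ((summable_nonzeroPeriod L).mul_left (2 * (‖z‖ + 1) ^ 3)) ?_
    filter_upwards [eventually_norm_primaryFactor_le L (‖z‖ + 1)] with γ hγ
    rw [norm_norm]
    exact hγ z (by simp)

lemma sigma_eq_zero_iff {z : ℂ} : sigma L z = 0 ↔ z ∈ L.lattice := by
  constructor
  · intro h
    by_contra hz
    rw [sigma_eq_tprod] at h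
    rcases mul_eq_zero.1 h with h | h
    · exact hz (h ▸ zero_mem _)
    · exact tprod_primaryFactor_ne_zero L (.inl hz) h
  · intro h
    by_cases hz : z = 0
    · simp [sigma, hz]
    · rw [sigma, tprod_of_exists_eq_zero, mul_zero]
      refine ⟨⟨⟨z, h⟩, by simpa using hz⟩, ?_⟩
      simp [div_self hz]

lemma sigma_neg (z : ℂ) : sigma L (-z) = -sigma L z := by
  rw [sigma, sigma, neg_mul, neg_inj]
  congr 1
  let e : NonzeroPeriod L ≃ NonzeroPeriod L := (Equiv.neg L.lattice).subtypeEquiv (by simp)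
  rw [← e.tprod_eq]
  refine tprod_congr fun γ => ?_
  simp [e]

lemma hasDerivAt_sigma_zero : HasDerivAt (sigma L) 1 0 := by
  rw [show sigma L = fun z => _ from funext (sigma_eq_tprod L)]
  have h := (hasDerivAt_id' (0 : ℂ)).fun_mul
    (differentiable_tprod_primaryFactor L 0).hasDerivAt
  simpa [primaryFactor] using h

/-- The summand `1/(z + γ) - 1/γ + z/γ²` of the Weierstrass zeta function. At `γ = 0` the
convention `1 / 0 = 0` leaves the expected term `1 / z`. -/
def zetaTerm (z γ : ℂ) : ℂ := 1 / (z + γ) - 1 / γ + z / γ ^ 2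

/-- The Weierstrass zeta function `ζ(z) = 1/z + ∑_{γ ≠ 0} (1/(z + γ) - 1/γ + z/γ²)`. -/
def wzeta (z : ℂ) : ℂ := ∑' γ : L.lattice, zetaTerm z γ

lemma norm_zetaTerm_le {z γ : ℂ} (h : 2 * ‖z‖ ≤ ‖γ‖) (hγ : γ ≠ 0) :
    ‖zetaTerm z γ‖ ≤ 2 * ‖z‖ ^ 2 * ‖γ‖ ^ (-3 : ℝ) := by
  have hγ0 : 0 < ‖γ‖ := norm_pos_iff.2 hγ
  have hle : ‖γ‖ / 2 ≤ ‖z + γ‖ := by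
    have := norm_sub_norm_le γ (-z)
    rw [norm_neg, sub_neg_eq_add, add_comm] at this
    linarith
  have hne : z + γ ≠ 0 := norm_pos_iff.1 (lt_of_lt_of_le (by linarith) hle)
  have h1 : zetaTerm z γ = z ^ 2 / (γ ^ 2 * (z + γ)) := by
    unfold zetaTerm
    field_simp
    ring
  have h3 : ‖γ‖ ^ (-3 : ℝ) = (‖γ‖ ^ 3)⁻¹ := by
    rw [Real.rpow_neg (norm_nonneg _)]
    norm_cast
  rw [h1, h3, norm_div, norm_mul, norm_pow, norm_pow]
  calc ‖z‖ ^ 2 / (‖γ‖ ^ 2 * ‖z + γ‖) ≤ ‖z‖ ^ 2 / (‖γ‖ ^ 2 * (‖γ‖ / 2)) := by gcongr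
    _ = 2 * ‖z‖ ^ 2 * (‖γ‖ ^ 3)⁻¹ := by
      field_simp

lemma summable_zetaTerm (z : ℂ) : Summable fun γ : L.lattice => zetaTerm z γ := by
  refine Summable.of_norm_bounded_eventually
    ((summable_norm_rpow_lattice L (r := -3) (by norm_num)).mul_left (2 * ‖z‖ ^ 2)) ?_
  have h : ∀ᶠ γ : L.lattice in cofinite, ¬ ‖(γ : ℂ)‖ < 2 * ‖z‖ + 1 :=
    (finite_setOf_norm_lattice_lt L _).eventually_cofinite_notMem
  filter_upwards [h] with γ hγ
  have h1 : 0 < ‖(γ : ℂ)‖ := by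
    have := norm_nonneg z
    linarith [not_lt.1 hγ]
  exact norm_zetaTerm_le (by linarith [not_lt.1 hγ]) (norm_pos_iff.1 h1)

lemma logDeriv_primaryFactor {z γ : ℂ} (hγ : γ ≠ 0) (hz : z ≠ γ) :
    logDeriv (fun z => 1 + (primaryFactor (z / γ) - 1)) z = zetaTerm z (-γ) := by
  have hz' : γ - z ≠ 0 := sub_ne_zero.2 hz.symm
  have hz'' : z - γ ≠ 0 := sub_ne_zero.2 hz
  have h1 : HasDerivAt (fun z : ℂ => 1 - z / γ) (-(1 / γ)) z := by
    simpa using ((hasDerivAt_id z).div_const γ).const_sub 1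
  have h2 : HasDerivAt (fun z : ℂ => z / γ + (z / γ) ^ 2 / 2) (1 / γ + z / γ ^ 2) z := by
    have := ((hasDerivAt_id' z).div_const γ).fun_add
      ((((hasDerivAt_id' z).div_const γ).fun_pow 2).div_const 2)
    have he : 1 / γ + ((2 : ℕ) : ℂ) * (z / γ) ^ (2 - 1) * (1 / γ) / 2 = 1 / γ + z / γ ^ 2 := by
      simp
      field_simp
    exact he ▸ this
  have h3 := h1.fun_mul h2.cexp
  have hf : (fun z => 1 + (primaryFactor (z / γ) - 1)) =
      fun z => (1 - z / γ) * exp (z / γ + (z / γ) ^ 2 / 2) := by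
    ext; simp [primaryFactor]
  rw [hf, logDeriv_apply]
  rw [h3.deriv]
  have he := exp_ne_zero (z / γ + (z / γ) ^ 2 / 2)
  have h4 : (1 - z / γ) ≠ 0 := by
    rw [one_sub_div hγ]
    exact div_ne_zero hz' hγ
  unfold zetaTerm
  rw [← sub_eq_add_neg]
  generalize exp (z / γ + (z / γ) ^ 2 / 2) = e at *
  rw [one_sub_div hγ] at *
  field_simp
  ring

/-- Away from the lattice, the logarithmic derivative of `σ` is the Weierstrass zeta function. -/
lemma deriv_sigma {z : ℂ} (hz : z ∉ L.lattice) :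
    deriv (sigma L) z = wzeta L z * sigma L z := by
  have hz0 : z ≠ 0 := fun h => hz (h ▸ zero_mem _)
  have hne : ∀ γ : NonzeroPeriod L, (γ.1 : ℂ) ≠ 0 := fun γ => by simpa using γ.2
  have hne' : ∀ γ : NonzeroPeriod L, z ≠ γ.1 := fun γ h => hz (h ▸ γ.1.2)
  have hld : ∀ γ : NonzeroPeriod L,
      logDeriv (fun z => 1 + (primaryFactor (z / γ.1) - 1)) z = zetaTerm z (-γ.1) :=
    fun γ => logDeriv_primaryFactor (hne γ) (hne' γ)
  have hs : Summable fun γ : L.lattice => zetaTerm z (-(γ : ℂ)) := by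
    simpa [Function.comp_def] using (Equiv.neg L.lattice).summable_iff.2 (summable_zetaTerm L z)
  have hs' : Summable fun γ : NonzeroPeriod L => zetaTerm z (-(γ.1 : ℂ)) :=
    hs.comp_injective Subtype.val_injective
  have hP := tprod_primaryFactor_ne_zero L (.inl hz)
  have h1 := logDeriv_tprod_eq_tsum (s := Metric.ball (0 : ℂ) (‖z‖ + 1)) Metric.isOpen_ball
    (x := z) (by simp) (f := fun (γ : NonzeroPeriod L) z => 1 + (primaryFactor (z / (γ.1 : ℂ)) - 1))
    (fun γ h => by
      have := congrArg (· = 0) h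
      simp only [primaryFactor, add_sub_cancel, mul_eq_zero, exp_ne_zero, or_false, eq_iff_iff,
        iff_true] at this
      have h2 := hne γ
      field_simp at this
      exact hne' γ (by linear_combination -this))
    (fun γ => by unfold primaryFactor; fun_prop) (by simpa only [hld] using hs')
    (multipliableLocallyUniformlyOn_primaryFactor L _) hP
  simp only [hld] at h1
  have h2 : wzeta L z = 1 / z + ∑' γ : NonzeroPeriod L, zetaTerm z (-(γ.1 : ℂ)) := by
    have h3 := hasSum_lattice_of_nonzero L (f := fun γ => zetaTerm z (-(γ : ℂ))) hs'.hasSum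
    rw [wzeta, ← (Equiv.neg L.lattice).tsum_eq]
    simpa [zetaTerm] using h3.tsum_eq
  rw [h2, ← h1, logDeriv_apply]
  have hd := (hasDerivAt_id' z).fun_mul (differentiable_tprod_primaryFactor L z).hasDerivAt
  have hs3 : sigma L = fun z => z * ∏' γ : NonzeroPeriod L,
      (1 + (primaryFactor (z / (γ.1 : ℂ)) - 1)) := funext (sigma_eq_tprod L)
  rw [← hs3] at hd
  rw [hd.deriv, sigma_eq_tprod]
  field_simp

/-! ### The residue at `s = 1` of the lattice zeta function -/

/-- The number of lattice points `γ` with `⌈|γ|²⌉ = n`. -/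
def shellCount (n : ℕ) : ℕ := Nat.card {γ : L.lattice // ⌈‖(γ : ℂ)‖ ^ 2⌉₊ = n}

lemma finite_setOf_norm_sq_le (r : ℝ) : {γ : L.lattice | ‖(γ : ℂ)‖ ^ 2 ≤ r}.Finite := by
  refine (finite_setOf_norm_lattice_lt L (|r| + 2)).subset fun γ hγ => ?_
  have h1 : ‖(γ : ℂ)‖ ^ 2 ≤ r := hγ
  have h2 := le_abs_self r
  have h3 := abs_nonneg r
  change ‖(γ : ℂ)‖ < |r| + 2
  nlinarith [norm_nonneg (γ : ℂ)]

lemma sum_shellCount (n : ℕ) :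
    ∑ k ∈ Finset.Icc 0 n, shellCount L k = Nat.card {γ : L.lattice // ‖(γ : ℂ)‖ ^ 2 ≤ n} := by
  classical
  have hfin := finite_setOf_norm_sq_le L n
  set S := hfin.toFinset with hS
  have hmem : ∀ γ, γ ∈ S ↔ ‖(γ : ℂ)‖ ^ 2 ≤ n := fun γ => by simp [hS]
  have h1 : Nat.card {γ : L.lattice // ‖(γ : ℂ)‖ ^ 2 ≤ n} = S.card :=
    Nat.subtype_card S hmem
  rw [h1, Finset.card_eq_sum_card_fiberwise (f := fun γ : L.lattice => ⌈‖(γ : ℂ)‖ ^ 2⌉₊)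
    (t := Finset.Icc 0 n)]
  · refine Finset.sum_congr rfl fun k hk => ?_
    rw [shellCount, Nat.subtype_card]
    intro γ
    simp only [Finset.mem_filter, hmem, and_iff_right_iff_imp]
    intro h
    have := Nat.le_ceil (‖(γ : ℂ)‖ ^ 2)
    rw [h] at this
    exact this.trans (by exact_mod_cast (Finset.mem_Icc.1 hk).2)
  · intro γ hγ
    have := (hmem γ).1 hγ
    simpa using this

lemma tendsto_card_lattice_div :
    Tendsto (fun c : ℝ => (Nat.card {γ : L.lattice // ‖(γ : ℂ)‖ ^ 2 ≤ c} : ℝ) / c) atTop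
      (𝓝 (Real.pi / ZLattice.covolume L.lattice)) := by
  have hset : {x ∈ (Set.univ : Set ℂ) | ‖x‖ ^ 2 ≤ 1} = Metric.closedBall 0 1 := by
    ext x
    simp
  have h := ZLattice.covolume.tendsto_card_le_div' (L := L.lattice) (X := (Set.univ : Set ℂ))
    (F := fun x => ‖x‖ ^ 2) (by simp) (by
      intro x r hr
      rw [norm_smul, Complex.finrank_real_complex, mul_pow, Real.norm_of_nonneg hr])
    (by rw [hset]; exact Metric.isBounded_closedBall)
    (by rw [hset]; exact measurableSet_closedBall)
    (by
      rw [hset, frontier_closedBall _ one_ne_zero]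
      exact MeasureTheory.Measure.addHaar_sphere _ _ _)
  rw [hset] at h
  have hv : MeasureTheory.volume.real (Metric.closedBall (0 : ℂ) 1) = Real.pi := by
    simp [MeasureTheory.measureReal_def]
  rw [hv] at h
  refine h.congr fun c => ?_
  congr 2
  refine Nat.card_congr ?_
  exact
    { toFun := fun x => ⟨⟨x.1, x.2.2⟩, x.2.1.2⟩
      invFun := fun x => ⟨x.1.1, ⟨trivial, x.2⟩, x.1.2⟩
      left_inv := fun _ => rfl
      right_inv := fun _ => rfl }

lemma tendsto_sum_shellCount :
    Tendsto (fun n : ℕ => (∑ k ∈ Finset.Icc 1 n, (shellCount L k : ℝ)) / n) atTop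
      (𝓝 (Real.pi / ZLattice.covolume L.lattice)) := by
  have h1 := (tendsto_card_lattice_div L).comp tendsto_natCast_atTop_atTop
  have h2 : Tendsto (fun n : ℕ => (shellCount L 0 : ℝ) / n) atTop (𝓝 0) :=
    tendsto_const_div_atTop_nhds_zero_nat _
  have h3 := h1.sub h2
  rw [sub_zero] at h3
  refine h3.congr fun n => ?_
  simp only [Function.comp_apply]
  rw [← sub_div, ← sum_shellCount]
  congr 1
  push_cast
  rw [← Finset.add_sum_Ioc_eq_sum_Icc (Nat.zero_le n)]
  simp [add_sub_cancel_left]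
  rfl

/-- Rounding up to the next integer changes `x ^ (-s)` by a term of one order smaller, by
Bernoulli's inequality. -/
lemma sub_ceil_rpow_le {x s : ℝ} (hx : 0 < x) (hs : 1 ≤ s) :
    0 ≤ x ^ (-s) - (⌈x⌉₊ : ℝ) ^ (-s) ∧ x ^ (-s) - (⌈x⌉₊ : ℝ) ^ (-s) ≤ s * x ^ (-s - 1) := by
  set N : ℝ := (⌈x⌉₊ : ℝ) with hN
  have h1 : x ≤ N := Nat.le_ceil x
  have h2 : N < x + 1 := Nat.ceil_lt_add_one hx.le
  have hN0 : 0 < N := hx.trans_le h1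
  refine ⟨sub_nonneg.2 (Real.rpow_le_rpow_of_nonpos hx h1 (by linarith)), ?_⟩
  have h3 : N ^ (-s) = x ^ (-s) * (1 + (x / N - 1)) ^ s := by
    rw [add_sub_cancel, Real.div_rpow hx.le hN0.le, Real.rpow_neg hx.le, Real.rpow_neg hN0.le]
    have := (Real.rpow_pos_of_pos hx s).ne'
    field_simp
  have h4 : 1 + s * (x / N - 1) ≤ (1 + (x / N - 1)) ^ s := by
    refine one_add_mul_self_le_rpow_one_add ?_ hs
    have : 0 ≤ x / N := by positivity
    linarith
  have h5 : -(1 / x) ≤ x / N - 1 := by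
    have h6 : (N - x) / N ≤ 1 / x := by
      rw [div_le_div_iff₀ hN0 hx]
      nlinarith
    have h7 : x / N - 1 = -((N - x) / N) := by
      field_simp
      ring
    rw [h7]
    linarith
  have h8 : 0 < x ^ (-s) := Real.rpow_pos_of_pos hx _
  have h9 : x ^ (-s - 1) = x ^ (-s) * (1 / x) := by
    rw [Real.rpow_sub_one hx.ne']
    ring
  rw [h3, h9]
  nlinarith [mul_le_mul_of_nonneg_left h4 h8.le,
    mul_le_mul_of_nonneg_left h5 (mul_nonneg h8.le (by linarith : 0 ≤ s))]

lemma ceil_rpow_bound (γ : ℂ) {s : ℝ} (h1 : 1 < s) (h2 : s < 2) :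
    ‖‖γ‖ ^ (-2 * s) - (⌈‖γ‖ ^ 2⌉₊ : ℝ) ^ (-s)‖ ≤
      2 * (‖γ‖ ^ (-4 : ℝ) + ‖γ‖ ^ (-6 : ℝ)) := by
  by_cases hγ : γ = 0
  · have h3 : -2 * s ≠ 0 := by linarith
    have h4 : -s ≠ 0 := by linarith
    simp [hγ, Real.zero_rpow h4]
    rw [Real.zero_rpow (by linarith)]
  · have hγ0 : 0 < ‖γ‖ := norm_pos_iff.2 hγ
    have hpow : ∀ t : ℝ, (‖γ‖ ^ 2) ^ t = ‖γ‖ ^ (2 * t) := fun t => by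
      rw [← Real.rpow_natCast, ← Real.rpow_mul hγ0.le]
      norm_num
    obtain ⟨h3, h4⟩ := sub_ceil_rpow_le (x := ‖γ‖ ^ 2) (s := s) (by positivity) h1.le
    rw [show -2 * s = 2 * (-s) by ring, ← hpow, Real.norm_of_nonneg h3]
    refine h4.trans ?_
    have h5 : (‖γ‖ ^ 2) ^ (-s - 1) ≤ ‖γ‖ ^ (-4 : ℝ) + ‖γ‖ ^ (-6 : ℝ) := by
      rw [hpow]
      have h6 : 0 < ‖γ‖ ^ (-4 : ℝ) := Real.rpow_pos_of_pos hγ0 _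
      have h7 : 0 < ‖γ‖ ^ (-6 : ℝ) := Real.rpow_pos_of_pos hγ0 _
      rcases le_total 1 ‖γ‖ with h | h
      · have := Real.rpow_le_rpow_of_exponent_le h (show 2 * (-s - 1) ≤ -4 by linarith)
        linarith
      · have := Real.rpow_le_rpow_of_exponent_ge hγ0 h (show -6 ≤ 2 * (-s - 1) by linarith)
        linarith
    have h6 : 0 ≤ (‖γ‖ ^ 2) ^ (-s - 1) := by positivity
    nlinarith

lemma summable_ceil_rpow {s : ℝ} (h1 : 1 < s) :
    Summable fun γ : L.lattice => (⌈‖(γ : ℂ)‖ ^ 2⌉₊ : ℝ) ^ (-s) := by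
  refine (summable_norm_rpow_lattice L (r := -2 * s) (by linarith)).of_nonneg_of_le
    (fun γ => by positivity) fun γ => ?_
  by_cases hγ : (γ : ℂ) = 0
  · have h4 : -s ≠ 0 := by linarith
    have h3 : -2 * s ≠ 0 := by linarith
    simp only [hγ, norm_zero]
    rw [Real.zero_rpow h3]
    simp [Real.zero_rpow h4]
  · have hγ0 : 0 < ‖(γ : ℂ)‖ := norm_pos_iff.2 hγ
    have h := (sub_ceil_rpow_le (x := ‖(γ : ℂ)‖ ^ 2) (s := s) (by positivity) h1.le).1
    have hpow : (‖(γ : ℂ)‖ ^ 2) ^ (-s) = ‖(γ : ℂ)‖ ^ (-2 * s) := by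
      rw [← Real.rpow_natCast, ← Real.rpow_mul hγ0.le]
      norm_num
    rw [hpow] at h
    exact sub_nonneg.1 h

lemma LSeries_shellCount {s : ℝ} (h1 : 1 < s) :
    LSeries (fun n => ((shellCount L n : ℝ) : ℂ)) s =
      ((∑' γ : L.lattice, (⌈‖(γ : ℂ)‖ ^ 2⌉₊ : ℝ) ^ (-s) : ℝ) : ℂ) := by
  have h := ((summable_ceil_rpow L h1).hasSum).tsum_fiberwise
    (fun γ : L.lattice => ⌈‖(γ : ℂ)‖ ^ 2⌉₊)
  rw [← h.tsum_eq, LSeries, ofReal_tsum]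
  refine tsum_congr fun n => ?_
  have h2 : ∀ γ : (fun γ : L.lattice => ⌈‖(γ : ℂ)‖ ^ 2⌉₊) ⁻¹' {n},
      (⌈‖((γ : L.lattice) : ℂ)‖ ^ 2⌉₊ : ℝ) ^ (-s) = (n : ℝ) ^ (-s) := fun γ => by
    have : ⌈‖((γ : L.lattice) : ℂ)‖ ^ 2⌉₊ = n := γ.2
    rw [this]
  rw [tsum_congr h2, tsum_const]
  have h3 : Nat.card ((fun γ : L.lattice => ⌈‖(γ : ℂ)‖ ^ 2⌉₊) ⁻¹' {n}) = shellCount L n := rfl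
  rw [h3]
  by_cases hn : n = 0
  · have h4 : -s ≠ 0 := by linarith
    subst hn
    simp [Real.zero_rpow h4]
  · rw [LSeries.term_of_ne_zero hn, nsmul_eq_mul, ofReal_mul, Real.rpow_neg (Nat.cast_nonneg _),
      ofReal_inv, ofReal_cpow (Nat.cast_nonneg _), div_eq_mul_inv]
    simp

/-- The residue at `s = 1` of `∑ |γ|^{-2s}` is `π` divided by the covolume: the Dirichlet series
with coefficients `shellCount` differs from it by a bounded function near `s = 1`, and its residue
is given by counting lattice points in large discs. -/
lemma tendsto_sub_one_mul_tsum_norm_rpow :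
    Tendsto (fun s : ℝ => (s - 1) * ∑' γ : L.lattice, ‖(γ : ℂ)‖ ^ (-2 * s)) (𝓝[>] 1)
      (𝓝 (Real.pi / ZLattice.covolume L.lattice)) := by
  have h1 := LSeries_tendsto_sub_mul_nhds_one_of_tendsto_sum_div_and_nonneg
    (fun n => (shellCount L n : ℝ)) (tendsto_sum_shellCount L) (fun n => Nat.cast_nonneg _)
  have h2 : Tendsto (fun s : ℝ => (s - 1) * ∑' γ : L.lattice, (⌈‖(γ : ℂ)‖ ^ 2⌉₊ : ℝ) ^ (-s))
      (𝓝[>] 1) (𝓝 (Real.pi / ZLattice.covolume L.lattice)) := by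
    refine tendsto_ofReal_iff.1 (h1.congr' ?_)
    filter_upwards [self_mem_nhdsWithin] with s hs
    rw [LSeries_shellCount L hs]
    push_cast
    rfl
  set C : ℝ := ∑' γ : L.lattice, 2 * (‖(γ : ℂ)‖ ^ (-4 : ℝ) + ‖(γ : ℂ)‖ ^ (-6 : ℝ)) with hC
  have hsC : Summable fun γ : L.lattice =>
      2 * (‖(γ : ℂ)‖ ^ (-4 : ℝ) + ‖(γ : ℂ)‖ ^ (-6 : ℝ)) :=
    ((summable_norm_rpow_lattice L (by norm_num)).add
      (summable_norm_rpow_lattice L (by norm_num))).mul_left 2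
  have h3 : Tendsto (fun s : ℝ => (s - 1) * (∑' γ : L.lattice, ‖(γ : ℂ)‖ ^ (-2 * s) -
      ∑' γ : L.lattice, (⌈‖(γ : ℂ)‖ ^ 2⌉₊ : ℝ) ^ (-s))) (𝓝[>] 1) (𝓝 0) := by
    have hz : Tendsto (fun s : ℝ => (s - 1) * C) (𝓝[>] 1) (𝓝 0) := by
      refine tendsto_nhdsWithin_of_tendsto_nhds ?_
      have : ContinuousAt (fun s : ℝ => (s - 1) * C) 1 := by fun_prop
      simpa [ContinuousAt] using this
    refine squeeze_zero_norm' ?_ hz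
    filter_upwards [Ioo_mem_nhdsGT (show (1 : ℝ) < 2 by norm_num)] with s hs
    have hs1 : 0 ≤ s - 1 := by linarith [hs.1]
    rw [norm_mul, Real.norm_of_nonneg hs1]
    refine mul_le_mul_of_nonneg_left ?_ hs1
    rw [← (summable_norm_rpow_lattice L (by linarith [hs.1])).tsum_sub
      (summable_ceil_rpow L hs.1)]
    exact tsum_of_norm_bounded hsC.hasSum fun γ => ceil_rpow_bound _ hs.1 hs.2
  have h4 := h3.add h2
  rw [zero_add] at h4
  exact h4.congr fun s => by ring

/-! ### Quasi-periods of the Weierstrass zeta function -/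

/-- The summand `w̄ |w|^{-2s}` of the Eisenstein–Kronecker series of weight one. It is `1/w` at
`s = 1`, and `0` for `w = 0`. -/
def heckeTerm (s : ℝ) (w : ℂ) : ℂ := conj w * ((‖w‖ ^ (-2 * s) : ℝ) : ℂ)

/-- The differential of `heckeTerm s` at `γ`, applied to `u`; it is `0` for `γ = 0`. -/
def heckeLin (s : ℝ) (γ u : ℂ) : ℂ :=
  -(s * (conj γ ^ 2 * ((‖γ‖ ^ (-2 * (s + 1)) : ℝ) : ℂ)) * u) +
    (1 - s) * ((‖γ‖ ^ (-2 * s) : ℝ) : ℂ) * conj u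

/-- The remainder of the first order Taylor expansion of `heckeTerm s` at `γ`. -/
def heckeRem (s : ℝ) (z γ : ℂ) : ℂ := heckeTerm s (z + γ) - heckeTerm s γ - heckeLin s γ z

lemma heckeTerm_mul (s : ℝ) (a b : ℂ) : heckeTerm s (a * b) = heckeTerm s a * heckeTerm s b := by
  simp only [heckeTerm, map_mul, norm_mul, Real.mul_rpow (norm_nonneg _) (norm_nonneg _),
    ofReal_mul]
  ring

lemma norm_heckeTerm {s : ℝ} (hs : 1 ≤ s) (w : ℂ) : ‖heckeTerm s w‖ = ‖w‖ ^ (1 - 2 * s) := by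
  by_cases hw : w = 0
  · have : (1 : ℝ) - 2 * s ≠ 0 := by linarith
    simp [heckeTerm, hw, Real.zero_rpow this]
  · have h : 0 < ‖w‖ := norm_pos_iff.2 hw
    rw [heckeTerm, norm_mul, norm_real, Real.norm_of_nonneg (by positivity), RCLike.norm_conj,
      show (1 : ℝ) - 2 * s = 1 + -2 * s by ring, Real.rpow_add h, Real.rpow_one]

lemma heckeTerm_one_add {u : ℂ} (hu : ‖u‖ < 1) (s : ℝ) :
    heckeTerm s (1 + u) = exp (-s * log (1 + u) + (1 - s) * conj (log (1 + u))) := by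
  have h1 : 1 + u ∈ slitPlane := mem_slitPlane_of_norm_lt_one hu
  have h0 : 1 + u ≠ 0 := slitPlane_ne_zero h1
  have hn : 0 < ‖1 + u‖ := norm_pos_iff.2 h0
  have hre : ((Real.log ‖1 + u‖ : ℝ) : ℂ) = (log (1 + u) + conj (log (1 + u))) / 2 := by
    rw [← log_re, re_eq_add_conj]
  have hc : conj (1 + u) = exp (conj (log (1 + u))) := by
    rw [exp_conj, exp_log h0]
  rw [heckeTerm, hc, Real.rpow_def_of_pos hn, ofReal_exp, ofReal_mul, hre, ← Complex.exp_add]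
  congr 1
  push_cast
  ring

lemma norm_heckeTerm_one_add_sub_le {u : ℂ} (hu : ‖u‖ ≤ 1 / 8) {s : ℝ} (h1 : 1 ≤ s) (h2 : s ≤ 2) :
    ‖heckeTerm s (1 + u) - 1 - (-s * u + (1 - s) * conj u)‖ ≤ 24 * ‖u‖ ^ 2 := by
  have hu1 : ‖u‖ < 1 := by linarith
  have hu0 := norm_nonneg u
  set l := log (1 + u) with hl
  have hd : ‖l - u‖ ≤ ‖u‖ ^ 2 := by
    refine (norm_log_one_add_sub_self_le hu1).trans ?_
    have h3 : (1 - ‖u‖)⁻¹ ≤ 2 := by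
      rw [inv_le_comm₀ (by linarith) (by norm_num)]
      linarith
    nlinarith [sq_nonneg ‖u‖]
  have hln : ‖l‖ ≤ 3 / 2 * ‖u‖ := norm_log_one_add_half_le_self (by linarith)
  have key : ∀ v : ℂ, ‖-(s : ℂ) * v + (1 - s) * conj v‖ ≤ 3 * ‖v‖ := fun v => by
    refine (norm_add_le _ _).trans ?_
    have e1 : ‖-(s : ℂ)‖ = s := by rw [norm_neg, norm_real, Real.norm_of_nonneg (by linarith)]
    have e2 : ‖(1 - s : ℂ)‖ = s - 1 := by
      rw [norm_sub_rev, ← ofReal_one, ← ofReal_sub, norm_real, Real.norm_of_nonneg (by linarith)]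
    rw [norm_mul, norm_mul, e1, e2, RCLike.norm_conj]
    nlinarith [norm_nonneg v]
  set E := -(s : ℂ) * l + (1 - s) * conj l with hE
  have hEn : ‖E‖ ≤ 9 / 2 * ‖u‖ := (key l).trans (by linarith)
  have hE1 : ‖E‖ ≤ 1 := by linarith
  have hEL : ‖E - (-s * u + (1 - s) * conj u)‖ ≤ 3 * ‖u‖ ^ 2 := by
    have := key (l - u)
    rw [map_sub] at this
    calc _ = ‖-(s : ℂ) * (l - u) + (1 - s) * (conj l - conj u)‖ := by
          congr 1
          rw [hE]
          ring
      _ ≤ _ := this.trans (by linarith)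
  rw [heckeTerm_one_add hu1, ← hl, ← hE]
  calc _ = ‖(exp E - 1 - E) + (E - (-s * u + (1 - s) * conj u))‖ := by congr 1; ring
    _ ≤ ‖E‖ ^ 2 + 3 * ‖u‖ ^ 2 :=
      (norm_add_le _ _).trans (add_le_add (norm_exp_sub_one_sub_id_le hE1) hEL)
    _ ≤ 24 * ‖u‖ ^ 2 := by nlinarith [norm_nonneg E]

lemma norm_heckeRem_le {z γ : ℂ} (h : 8 * ‖z‖ + 1 ≤ ‖γ‖) {s : ℝ} (h1 : 1 ≤ s) (h2 : s ≤ 2) :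
    ‖heckeRem s z γ‖ ≤ 24 * ‖z‖ ^ 2 * ‖γ‖ ^ (-3 : ℝ) := by
  have hz := norm_nonneg z
  have hγ1 : 1 ≤ ‖γ‖ := by linarith
  have hγp : 0 < ‖γ‖ := by linarith
  have hγ : γ ≠ 0 := norm_pos_iff.1 hγp
  have hγc : conj γ ≠ 0 := by simpa using hγ
  have hu : ‖z / γ‖ ≤ 1 / 8 := by
    rw [norm_div, div_le_iff₀ hγp]
    linarith
  have hrp : ‖γ‖ ^ (-2 * (s + 1)) = ‖γ‖ ^ (-2 * s) / ‖γ‖ ^ 2 := by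
    rw [show -2 * (s + 1) = -2 * s - (2 : ℕ) by push_cast; ring, Real.rpow_sub_natCast hγp.ne']
  have hn2 : ((‖γ‖ : ℝ) : ℂ) ^ 2 = γ * conj γ := by
    rw [mul_conj, normSq_eq_norm_sq]
    push_cast
    rfl
  have hrem : heckeRem s z γ = heckeTerm s γ *
      (heckeTerm s (1 + z / γ) - 1 - (-s * (z / γ) + (1 - s) * conj (z / γ))) := by
    have e1 : z + γ = γ * (1 + z / γ) := by
      field_simp
      ring
    rw [heckeRem, e1, heckeTerm_mul]
    have e2 : heckeLin s γ z = heckeTerm s γ * (-s * (z / γ) + (1 - s) * conj (z / γ)) := by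
      rw [heckeLin, hrp, heckeTerm, map_div₀, ofReal_div, ofReal_pow, hn2]
      field_simp
    rw [e2]
    ring
  rw [hrem, norm_mul, norm_heckeTerm h1]
  have h3 : ‖γ‖ ^ (1 - 2 * s) ≤ ‖γ‖ ^ (-1 : ℝ) :=
    Real.rpow_le_rpow_of_exponent_le hγ1 (by linarith)
  refine (mul_le_mul h3 (norm_heckeTerm_one_add_sub_le hu h1 h2) (norm_nonneg _)
    (by positivity)).trans (le_of_eq ?_)
  rw [norm_div, Real.rpow_neg hγp.le, Real.rpow_neg hγp.le, Real.rpow_one]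
  norm_cast
  field_simp

lemma eventually_norm_heckeRem_le (z : ℂ) {s : ℝ} (h1 : 1 ≤ s) (h2 : s ≤ 2) :
    ∀ᶠ γ : L.lattice in cofinite, ‖heckeRem s z γ‖ ≤ 24 * ‖z‖ ^ 2 * ‖(γ : ℂ)‖ ^ (-3 : ℝ) := by
  have h : ∀ᶠ γ : L.lattice in cofinite, ¬ ‖(γ : ℂ)‖ < 8 * ‖z‖ + 1 :=
    (finite_setOf_norm_lattice_lt L _).eventually_cofinite_notMem
  filter_upwards [h] with γ hγ
  exact norm_heckeRem_le (not_lt.1 hγ) h1 h2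

lemma summable_heckeRem (z : ℂ) {s : ℝ} (h1 : 1 ≤ s) (h2 : s ≤ 2) :
    Summable fun γ : L.lattice => heckeRem s z γ :=
  Summable.of_norm_bounded_eventually
    ((summable_norm_rpow_lattice L (r := -3) (by norm_num)).mul_left (24 * ‖z‖ ^ 2))
    (eventually_norm_heckeRem_le L z h1 h2)

lemma heckeRem_one (z γ : ℂ) : heckeRem 1 z γ = zetaTerm z γ := by
  have h1 : ∀ w : ℂ, heckeTerm 1 w = 1 / w := fun w => by
    rw [heckeTerm, one_div, inv_def, normSq_eq_norm_sq, mul_one,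
      show (-2 : ℝ) = ((-2 : ℤ) : ℝ) by norm_num, Real.rpow_intCast]
    simp
  have h2 : conj γ ^ 2 * ((‖γ‖ ^ (-2 * ((1 : ℝ) + 1)) : ℝ) : ℂ) = 1 / γ ^ 2 := by
    rw [one_div, ← inv_pow, inv_def, normSq_eq_norm_sq,
      show (-2 * ((1 : ℝ) + 1)) = ((-4 : ℤ) : ℝ) by norm_num, Real.rpow_intCast]
    simp
    rw [mul_pow]
    congr 1
    norm_cast
    simp [← pow_mul]
  rw [heckeRem, h1, h1, heckeLin, ofReal_one, one_mul, h2, zetaTerm]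
  ring

lemma continuousAt_norm_rpow (w : ℂ) {a : ℝ → ℝ} (ha : ContinuousAt a 1) (h : a 1 ≠ 0) :
    ContinuousAt (fun s : ℝ => ((‖w‖ ^ a s : ℝ) : ℂ)) 1 := by
  have h1 : ContinuousAt (fun s : ℝ => ‖w‖ ^ a s) 1 :=
    ContinuousAt.comp (g := fun x : ℝ => ‖w‖ ^ x) (Real.continuousAt_const_rpow' h) ha
  exact continuous_ofReal.continuousAt.comp h1

lemma continuousAt_heckeRem (z γ : ℂ) : ContinuousAt (fun s => heckeRem s z γ) 1 := by
  have h1 : ∀ w : ℂ, ContinuousAt (fun s : ℝ => ((‖w‖ ^ (-2 * s) : ℝ) : ℂ)) 1 := fun w =>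
    continuousAt_norm_rpow w (by fun_prop) (by norm_num)
  have h2 : ∀ w : ℂ, ContinuousAt (fun s : ℝ => ((‖w‖ ^ (-2 * (s + 1)) : ℝ) : ℂ)) 1 := fun w =>
    continuousAt_norm_rpow w (by fun_prop) (by norm_num)
  have := h1 γ
  have := h1 (z + γ)
  have := h2 γ
  unfold heckeRem heckeTerm heckeLin
  fun_prop

/-- The series of remainders converges absolutely and uniformly near `s = 1`, where its terms are
those of the Weierstrass zeta function. -/
lemma tendsto_tsum_heckeRem (z : ℂ) :
    Tendsto (fun s : ℝ => ∑' γ : L.lattice, heckeRem s z γ) (𝓝[>] 1) (𝓝 (wzeta L z)) := by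
  classical
  have hw : wzeta L z = ∑' γ : L.lattice, heckeRem 1 z γ := by
    simp only [wzeta, heckeRem_one]
  rw [hw]
  have hfin := finite_setOf_norm_lattice_lt L (8 * ‖z‖ + 1)
  -- The finitely many `γ` close to `0`, where the Taylor bound fails, are bounded by continuity.
  set b : L.lattice → ℝ := fun γ =>
    24 * ‖z‖ ^ 2 * ‖(γ : ℂ)‖ ^ (-3 : ℝ) + if ‖(γ : ℂ)‖ < 8 * ‖z‖ + 1 then ‖heckeRem 1 z γ‖ + 1 else 0
    with hb
  have hbs : Summable b := by
    refine ((summable_norm_rpow_lattice L (r := -3) (by norm_num)).mul_left _).add ?_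
    refine summable_of_hasFiniteSupport (hfin.subset fun γ hγ => ?_)
    by_contra h
    exact hγ (if_neg h)
  refine tendsto_tsum_of_dominated_convergence hbs
    (fun γ => (continuousAt_heckeRem z γ).tendsto.mono_left nhdsWithin_le_nhds) ?_
  have hsmall : ∀ᶠ s in 𝓝[>] (1 : ℝ), ∀ γ ∈ {γ : L.lattice | ‖(γ : ℂ)‖ < 8 * ‖z‖ + 1},
      ‖heckeRem s z γ‖ ≤ ‖heckeRem 1 z γ‖ + 1 := by
    rw [Filter.eventually_all_finite hfin]
    intro γ _
    have := (continuousAt_heckeRem z γ).norm.tendsto.mono_left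
      (nhdsWithin_le_nhds (s := Set.Ioi 1))
    exact this.eventually_le_const (lt_add_one _)
  filter_upwards [hsmall, Ioo_mem_nhdsGT (show (1 : ℝ) < 2 by norm_num)] with s hs hs2 γ
  by_cases h : ‖(γ : ℂ)‖ < 8 * ‖z‖ + 1
  · have h0 : 0 ≤ 24 * ‖z‖ ^ 2 * ‖(γ : ℂ)‖ ^ (-3 : ℝ) := by positivity
    simp only [hb, if_pos h]
    linarith [hs γ h]
  · simp only [hb, if_neg h, add_zero]
    exact norm_heckeRem_le (not_lt.1 h) hs2.1.le hs2.2.le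

lemma hasSum_int_telescope {k : ℤ → ℂ} (hs : Summable fun m => k (m + 1) - k m)
    (h1 : Tendsto (fun n : ℕ => k n) atTop (𝓝 0))
    (h2 : Tendsto (fun n : ℕ => k (-n)) atTop (𝓝 0)) : HasSum (fun m => k (m + 1) - k m) 0 := by
  have hp : Summable fun n : ℕ => k (n + 1) - k n :=
    hs.comp_injective (i := fun n : ℕ => (n : ℤ)) Nat.cast_injective
  have hn : Summable fun n : ℕ => k (-(n + 1 : ℤ) + 1) - k (-(n + 1 : ℤ)) :=
    hs.comp_injective (i := fun n : ℕ => -(n + 1 : ℤ)) fun a b hab => by simpa using hab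
  have hp' : HasSum (fun n : ℕ => k (n + 1) - k n) (0 - k 0) := by
    rw [hp.hasSum_iff_tendsto_nat]
    refine (h1.sub_const (k 0)).congr fun n => ?_
    have := Finset.sum_range_sub (fun n : ℕ => k n) n
    simpa using this.symm
  have hn' : HasSum (fun n : ℕ => k (-(n + 1 : ℤ) + 1) - k (-(n + 1 : ℤ))) (k 0 - 0) := by
    rw [hn.hasSum_iff_tendsto_nat]
    refine (h2.const_sub (k 0)).congr fun n => ?_
    have := Finset.sum_range_sub' (fun n : ℕ => k (-n)) n
    simp only [Nat.cast_zero, neg_zero] at this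
    rw [← this]
    refine Finset.sum_congr rfl fun i _ => ?_
    push_cast
    congr 2
    ring
  have := hp'.of_nat_of_neg_add_one (f := fun m => k (m + 1) - k m) hn'
  simpa using this

lemma tendsto_heckeTerm_line {s : ℝ} (hs : 1 ≤ s) (c : ℂ) {ω : ℂ} (hω : ω ≠ 0) :
    Tendsto (fun n : ℕ => heckeTerm s (c + n * ω)) atTop (𝓝 0) := by
  rw [tendsto_zero_iff_norm_tendsto_zero]
  simp only [norm_heckeTerm hs]
  have h1 : Tendsto (fun n : ℕ => ‖c + n * ω‖) atTop atTop := by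
    have h2 : Tendsto (fun n : ℕ => (n : ℝ) * ‖ω‖ + -‖c‖) atTop atTop :=
      tendsto_atTop_add_const_right _ _
        (tendsto_natCast_atTop_atTop.atTop_mul_const (norm_pos_iff.2 hω))
    refine tendsto_atTop_mono (fun n => ?_) h2
    have := norm_sub_norm_le ((n : ℂ) * ω) (-c)
    rw [norm_neg, sub_neg_eq_add, norm_mul, norm_natCast, add_comm (_ * ω)] at this
    linarith
  have h3 := (tendsto_rpow_neg_atTop (y := 2 * s - 1) (by linarith)).comp h1
  refine h3.congr fun n => ?_
  simp

lemma hasSum_heckeTerm_line {s : ℝ} (hs : 1 ≤ s) (c : ℂ) {ω : ℂ} (hω : ω ≠ 0)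
    (h : Summable fun m : ℤ => heckeTerm s (c + ω + m * ω) - heckeTerm s (c + m * ω)) :
    HasSum (fun m : ℤ => heckeTerm s (c + ω + m * ω) - heckeTerm s (c + m * ω)) 0 := by
  have e : ∀ m : ℤ, heckeTerm s (c + ω + m * ω) = heckeTerm s (c + (m + 1 : ℤ) * ω) := fun m => by
    congr 1
    push_cast
    ring
  simp only [e] at h ⊢
  refine hasSum_int_telescope (k := fun m : ℤ => heckeTerm s (c + m * ω)) h ?_ ?_
  · simpa using tendsto_heckeTerm_line hs c hω
  · simpa using tendsto_heckeTerm_line hs c (neg_ne_zero.2 hω)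

/-- Summed over a coset of `ℤω`, the differences telescope. Only the series of differences has to
converge: the series `∑ heckeTerm s (z + γ)` itself need not, and for `s` near `1` it does not
converge absolutely. -/
lemma tsum_heckeTerm_shift {s : ℝ} (hs : 1 ≤ s) (z : ℂ) {ω ω' : ℂ} (hω : ω ≠ 0)
    (e : ℤ × ℤ ≃ L.lattice) (he : ∀ p, (e p : ℂ) = p.1 * ω' + p.2 * ω)
    (h : Summable fun γ : L.lattice => heckeTerm s (z + ω + γ) - heckeTerm s (z + γ)) :
    ∑' γ : L.lattice, (heckeTerm s (z + ω + γ) - heckeTerm s (z + γ)) = 0 := by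
  have h1 := e.summable_iff.2 h
  rw [← e.tsum_eq]
  simp only [Function.comp_def] at h1
  rw [h1.tsum_prod]
  refine (tsum_congr fun n => ?_).trans tsum_zero
  have h2 := h1.prod_factor n
  have e1 : ∀ m : ℤ, heckeTerm s (z + ω + (e (n, m) : ℂ)) - heckeTerm s (z + (e (n, m) : ℂ)) =
      heckeTerm s (z + n * ω' + ω + m * ω) - heckeTerm s (z + n * ω' + m * ω) := fun m => by
    rw [he]
    congr 2 <;> ring
  simp only [e1] at h2 ⊢
  exact (hasSum_heckeTerm_line hs _ hω h2).tsum_eq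

/-- A period which is a member of some `ℤ`-basis of the lattice. -/
def IsGenerator (ω : ℂ) : Prop :=
  ω ≠ 0 ∧ ∃ ω' : ℂ, ∃ e : ℤ × ℤ ≃ L.lattice, ∀ p, (e p : ℂ) = p.1 * ω' + p.2 * ω

lemma isGenerator_ω₁ : IsGenerator L L.ω₁ := by
  refine ⟨fun h => L.ω₁_div_two_notMem_lattice (by simp [h]), L.ω₂,
    (Equiv.prodComm ℤ ℤ).trans L.latticeEquivProd.symm.toEquiv, fun p => ?_⟩
  simpa [add_comm] using L.latticeEquiv_symm_apply p.swap

lemma isGenerator_ω₂ : IsGenerator L L.ω₂ := by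
  refine ⟨fun h => L.ω₂_div_two_notMem_lattice (by simp [h]), L.ω₁,
    L.latticeEquivProd.symm.toEquiv, fun p => ?_⟩
  simpa using L.latticeEquiv_symm_apply p

/-- The Eisenstein series whose limit at `s = 1` is `e*_{0,2}`, summed over the whole lattice. -/
def eisensteinTwo (s : ℝ) : ℂ :=
  ∑' γ : L.lattice, conj (γ : ℂ) ^ 2 * ((‖(γ : ℂ)‖ ^ (-2 * (s + 1)) : ℝ) : ℂ)

lemma summable_eisensteinTwo {s : ℝ} (hs : 1 < s) :
    Summable fun γ : L.lattice => conj (γ : ℂ) ^ 2 * ((‖(γ : ℂ)‖ ^ (-2 * (s + 1)) : ℝ) : ℂ) := by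
  refine Summable.of_norm_bounded (summable_norm_rpow_lattice L (r := -2 * s) (by linarith))
    fun γ => ?_
  by_cases hγ : (γ : ℂ) = 0
  · rw [hγ]
    simp
    positivity
  · have hp : 0 < ‖(γ : ℂ)‖ := norm_pos_iff.2 hγ
    rw [norm_mul, norm_pow, RCLike.norm_conj, norm_real, Real.norm_of_nonneg (by positivity),
      show -2 * (s + 1) = -2 * s - (2 : ℕ) by push_cast; ring, Real.rpow_sub_natCast hp.ne']
    field_simp
    exact le_rfl

/-- The vanishing of the series of differences `heckeTerm s (z + ω + γ) - heckeTerm s (z + γ)`,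
expanded by means of the first order Taylor expansion at `γ` of each term. -/
lemma eisensteinTwo_mul {s : ℝ} (h1 : 1 < s) (h2 : s < 2) (z : ℂ) {ω : ℂ}
    (hω : IsGenerator L ω) :
    s * ω * eisensteinTwo L s = (∑' γ : L.lattice, heckeRem s (z + ω) γ -
      ∑' γ : L.lattice, heckeRem s z γ) -
      conj ω * (((s - 1) * ∑' γ : L.lattice, ‖(γ : ℂ)‖ ^ (-2 * s) : ℝ) : ℂ) := by
  obtain ⟨hω0, ω', e, he⟩ := hω
  have hZ : Summable fun γ : L.lattice => ((‖(γ : ℂ)‖ ^ (-2 * s) : ℝ) : ℂ) :=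
    summable_ofReal.2 (summable_norm_rpow_lattice L (by linarith))
  have hG := summable_eisensteinTwo L h1
  have hR := (summable_heckeRem L (z + ω) h1.le h2.le).hasSum.sub
    (summable_heckeRem L z h1.le h2.le).hasSum
  have hall := (hR.sub (hG.hasSum.mul_left (s * ω))).add
    (hZ.hasSum.mul_left ((1 - s) * conj ω))
  have hterm : ∀ γ : L.lattice, heckeRem s (z + ω) γ - heckeRem s z γ -
      s * ω * (conj (γ : ℂ) ^ 2 * ((‖(γ : ℂ)‖ ^ (-2 * (s + 1)) : ℝ) : ℂ)) +
      (1 - s) * conj ω * ((‖(γ : ℂ)‖ ^ (-2 * s) : ℝ) : ℂ) =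
      heckeTerm s (z + ω + γ) - heckeTerm s (z + γ) := fun γ => by
    simp only [heckeRem, heckeLin, map_add]
    ring
  simp only [hterm] at hall
  have h0 := tsum_heckeTerm_shift L h1.le z hω0 e he hall.summable
  rw [hall.tsum_eq] at h0
  rw [eisensteinTwo, ofReal_mul, ofReal_tsum]
  push_cast at h0 ⊢
  linear_combination -h0

/-- In particular the limit defining `e*_{0,2}` exists. -/
lemma tendsto_eisensteinTwo (z : ℂ) {ω : ℂ} (hω : IsGenerator L ω) :
    Tendsto (eisensteinTwo L) (𝓝[>] 1)
      (𝓝 ((wzeta L (z + ω) - wzeta L z - conj ω / areaDivPi L) / ω)) := by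
  have hω0 := hω.1
  have hres : Tendsto (fun s : ℝ =>
      (((s - 1) * ∑' γ : L.lattice, ‖(γ : ℂ)‖ ^ (-2 * s) : ℝ) : ℂ)) (𝓝[>] 1)
      (𝓝 (1 / areaDivPi L)) := by
    have := tendsto_ofReal_iff.2 (tendsto_sub_one_mul_tsum_norm_rpow L)
    convert this using 2
    rw [areaDivPi, ← ofReal_one, ← ofReal_div, one_div_div]
  have hlim := ((tendsto_tsum_heckeRem L (z + ω)).sub (tendsto_tsum_heckeRem L z)).sub
    (hres.const_mul (conj ω))
  have hs : Tendsto (fun s : ℝ => (s : ℂ) * ω) (𝓝[>] 1) (𝓝 ω) := by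
    have : ContinuousAt (fun s : ℝ => (s : ℂ) * ω) 1 := by fun_prop
    simpa [ContinuousAt] using this.tendsto.mono_left nhdsWithin_le_nhds
  have hfin := hlim.div hs hω0
  rw [mul_one_div] at hfin
  refine hfin.congr' ?_
  filter_upwards [Ioo_mem_nhdsGT (show (1 : ℝ) < 2 by norm_num)] with s hs2
  have hs0 : (s : ℂ) ≠ 0 := by
    have := hs2.1
    exact_mod_cast (by linarith : s ≠ 0)
  have := eisensteinTwo_mul L hs2.1 hs2.2 z hω
  simp only [Pi.div_apply]
  rw [← this]
  field_simp

lemma eStar_eq_of_tendsto {l : ℂ} (h : Tendsto (eisensteinTwo L) (𝓝[>] 1) (𝓝 l)) :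
    eStar L = l := by
  refine Tendsto.limUnder_eq ?_
  have h1 : Tendsto (fun s : ℝ => s - 1) (𝓝[>] 2) (𝓝[>] 1) := by
    refine tendsto_nhdsWithin_iff.2 ⟨?_, ?_⟩
    · refine tendsto_nhdsWithin_of_tendsto_nhds ?_
      have : ContinuousAt (fun s : ℝ => s - 1) 2 := by fun_prop
      convert this.tendsto using 2
      norm_num
    · filter_upwards [self_mem_nhdsWithin] with s hs
      have : (2 : ℝ) < s := hs
      simp only [Set.mem_Ioi]
      linarith
  refine (h.comp h1).congr fun s => ?_
  simp only [Function.comp_apply, eisensteinTwo, sub_add_cancel]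
  refine (tsum_subtype_eq_of_support_subset (s := {γ : L.lattice | γ ≠ 0}) fun γ hγ h => ?_).symm
  exact hγ (by simp [h])

/-- The quasi-periods of the Weierstrass zeta function in terms of `e*_{0,2}`. -/
lemma wzeta_add_generator (z : ℂ) {ω : ℂ} (hω : IsGenerator L ω) :
    wzeta L (z + ω) - wzeta L z = eStar L * ω + conj ω / areaDivPi L := by
  rw [eStar_eq_of_tendsto L (tendsto_eisensteinTwo L z hω), div_mul_cancel₀ _ hω.1]
  ring

/-! ### Quasi-periodicity of the reduced theta function -/

lemma countable_lattice : (L.lattice : Set ℂ).Countable :=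
  Set.countable_coe_iff.1 (L.latticeEquivProd.toEquiv.countable_iff.2 inferInstance)

lemma dense_compl_lattice : Dense ((L.lattice : Set ℂ)ᶜ) := (countable_lattice L).dense_compl ℂ

lemma isPreconnected_compl_lattice : IsPreconnected ((L.lattice : Set ℂ)ᶜ) :=
  ((countable_lattice L).isConnected_compl_of_one_lt_rank
    (by rw [rank_real_complex]; norm_num)).isPreconnected

lemma areaDivPi_pos : 0 < areaDivPi L := div_pos (ZLattice.covolume_pos _ _) Real.pi_pos

lemma areaDivPi_ne_zero : (areaDivPi L : ℂ) ≠ 0 := ofReal_ne_zero.2 (areaDivPi_pos L).ne'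

lemma differentiable_theta : Differentiable ℂ (theta L) := by
  have := differentiable_sigma L
  unfold theta
  fun_prop

lemma theta_eq_zero_iff {z : ℂ} : theta L z = 0 ↔ z ∈ L.lattice := by
  simp [theta, exp_ne_zero, sigma_eq_zero_iff]

lemma theta_neg (z : ℂ) : theta L (-z) = -theta L z := by
  simp [theta, sigma_neg]

lemma theta_zero : theta L 0 = 0 := (theta_eq_zero_iff L).2 (zero_mem _)

lemma hasDerivAt_theta_exp (z : ℂ) : HasDerivAt (fun z => exp (-(eStar L) * z ^ 2 / 2))
    (exp (-(eStar L) * z ^ 2 / 2) * (-(eStar L) * z)) z := by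
  have h : HasDerivAt (fun z : ℂ => -(eStar L) * z ^ 2 / 2) (-(eStar L) * z) z := by
    have := ((hasDerivAt_pow 2 z).const_mul (-(eStar L))).div_const 2
    have he : -(eStar L) * (((2 : ℕ) : ℂ) * z ^ (2 - 1)) / 2 = -(eStar L) * z := by
      push_cast
      ring
    exact he ▸ this
  exact h.cexp

lemma hasDerivAt_theta_zero : HasDerivAt (theta L) 1 0 := by
  have h := (hasDerivAt_theta_exp L 0).fun_mul (hasDerivAt_sigma_zero L)
  have he : exp (-(eStar L) * 0 ^ 2 / 2) * (-(eStar L) * 0) * sigma L 0 +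
      exp (-(eStar L) * 0 ^ 2 / 2) * 1 = 1 := by simp
  exact he ▸ h

lemma hasDerivAt_theta {z : ℂ} (hz : z ∉ L.lattice) :
    HasDerivAt (theta L) ((wzeta L z - eStar L * z) * theta L z) z := by
  have hs : HasDerivAt (sigma L) (wzeta L z * sigma L z) z := by
    rw [← deriv_sigma L hz]
    exact (differentiable_sigma L z).hasDerivAt
  have h := (hasDerivAt_theta_exp L z).fun_mul hs
  have he : exp (-(eStar L) * z ^ 2 / 2) * (-(eStar L) * z) * sigma L z +
      exp (-(eStar L) * z ^ 2 / 2) * (wzeta L z * sigma L z) =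
      (wzeta L z - eStar L * z) * theta L z := by
    rw [theta]
    ring
  exact he ▸ h

/-- The quasi-periodicity of `θ` follows up to a constant by integrating its logarithmic derivative
along the complement of `Γ`; as `θ` is odd, evaluation at `-ω/2` gives the constant. -/
lemma theta_add_generator {ω : ℂ} (hω : IsGenerator L ω) (hmem : ω ∈ L.lattice)
    (h2 : ω / 2 ∉ L.lattice) (z : ℂ) :
    theta L (z + ω) = -exp (conj ω * (z + ω / 2) / areaDivPi L) * theta L z := by
  set A : ℂ := (areaDivPi L : ℂ) with hA
  have hA0 : A ≠ 0 := areaDivPi_ne_zero L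
  -- The quotient of both sides has vanishing derivative by the formula for the quasi-periods.
  set q : ℂ → ℂ := fun z => theta L (z + ω) * exp (-(conj ω / A * z)) / theta L z with hq
  have hd : ∀ z ∈ (L.lattice : Set ℂ)ᶜ, HasDerivAt q 0 z := by
    intro z hz
    have hz' : z ∉ L.lattice := hz
    have hzω : z + ω ∉ L.lattice := fun h => hz' (by simpa using sub_mem h hmem)
    have h0 : theta L z ≠ 0 := fun h => hz' ((theta_eq_zero_iff L).1 h)
    have d1 : HasDerivAt (fun z => theta L (z + ω))
        ((wzeta L (z + ω) - eStar L * (z + ω)) * theta L (z + ω)) z :=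
      (hasDerivAt_theta L hzω).comp_add_const z ω
    have d2 : HasDerivAt (fun z : ℂ => exp (-(conj ω / A * z)))
        (exp (-(conj ω / A * z)) * -(conj ω / A)) z := by
      have : HasDerivAt (fun z : ℂ => -(conj ω / A * z)) (-(conj ω / A)) z := by
        simpa using ((hasDerivAt_id' z).const_mul (conj ω / A)).fun_neg
      exact this.cexp
    have d3 := (d1.fun_mul d2).fun_div (hasDerivAt_theta L hz') h0
    have hz3 : wzeta L (z + ω) = wzeta L z + eStar L * ω + conj ω / A := by
      linear_combination wzeta_add_generator L z hω
    rw [hz3] at d3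
    refine HasDerivAt.congr_deriv d3 ?_
    rw [div_eq_zero_iff]
    left
    ring
  have hconst : ∃ c, ∀ z ∈ (L.lattice : Set ℂ)ᶜ, q z = c := by
    refine ⟨q (ω / 2), fun z hz => ?_⟩
    exact (L.isClosed_lattice.isOpen_compl).is_const_of_deriv_eq_zero
      (isPreconnected_compl_lattice L)
      (fun z hz => (hd z hz).differentiableAt.differentiableWithinAt)
      (fun z hz => (hd z hz).deriv) hz h2
  obtain ⟨c, hc⟩ := hconst
  have hc' : c = -exp (conj ω * (ω / 2) / A) := by
    have hm : -(ω / 2) ∈ (L.lattice : Set ℂ)ᶜ := fun h => h2 (by simpa using neg_mem h)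
    have h0 : theta L (ω / 2) ≠ 0 := fun h => h2 ((theta_eq_zero_iff L).1 h)
    rw [← hc _ hm]
    simp only [hq]
    rw [show -(ω / 2) + ω = ω / 2 by ring, theta_neg, div_neg, mul_div_cancel_left₀ _ h0]
    congr 2
    ring
  have hmain : ∀ z ∈ (L.lattice : Set ℂ)ᶜ,
      theta L (z + ω) = -exp (conj ω * (z + ω / 2) / A) * theta L z := by
    intro z hz
    have h0 : theta L z ≠ 0 := fun h => hz ((theta_eq_zero_iff L).1 h)
    have := hc z hz
    rw [hc'] at this
    simp only [hq] at this
    rw [div_eq_iff h0] at this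
    have he := Complex.exp_ne_zero (-(conj ω / A * z))
    apply mul_right_cancel₀ he
    rw [this, show conj ω * (z + ω / 2) / A = conj ω * (ω / 2) / A + conj ω / A * z by ring,
      Complex.exp_add, Complex.exp_neg]
    field_simp
  have hcont := (differentiable_theta L).continuous
  have := Continuous.ext_on (dense_compl_lattice L) (f := fun z => theta L (z + ω))
    (g := fun z => -exp (conj ω * (z + ω / 2) / A) * theta L z) (by fun_prop) (by fun_prop) hmain
  exact congrFun this z

/-- The bicharacter `E(z, w) = exp ((z w̄ - z̄ w) / (2A))` of `ℂ`, with values in the unit circle. -/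
def weil (z w : ℂ) : ℂ := exp ((z * conj w - conj z * w) / (2 * areaDivPi L))

lemma weil_ne_zero (z w : ℂ) : weil L z w ≠ 0 := exp_ne_zero _

lemma weil_add_left (a b w : ℂ) : weil L (a + b) w = weil L a w * weil L b w := by
  rw [weil, weil, weil, ← Complex.exp_add, map_add]
  congr 1
  ring

lemma weil_add_right (z a b : ℂ) : weil L z (a + b) = weil L z a * weil L z b := by
  rw [weil, weil, weil, ← Complex.exp_add, map_add]
  congr 1
  ring

lemma weil_zero_left (z : ℂ) : weil L 0 z = 1 := by simp [weil]

lemma weil_zero_right (z : ℂ) : weil L z 0 = 1 := by simp [weil]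

lemma weil_swap (z w : ℂ) : weil L w z = (weil L z w)⁻¹ := by
  rw [weil, weil, ← Complex.exp_neg]
  congr 1
  ring

lemma weil_nat_mul_left (n : ℕ) (z w : ℂ) : weil L (n * z) w = weil L z w ^ n := by
  rw [weil, weil, ← Complex.exp_nat_mul]
  congr 1
  simp
  ring

/-- The adjunction formula for multiplication by a complex number. -/
lemma weil_mul_left (a z w : ℂ) : weil L (a * z) w = weil L z (conj a * w) := by
  rw [weil, weil]
  congr 1
  simp
  ring

lemma norm_weil (z w : ℂ) : ‖weil L z w‖ = 1 := by
  rw [weil, norm_exp]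
  have : ((z * conj w - conj z * w) / (2 * areaDivPi L)) =
      ((2 * (z * conj w).im / (2 * areaDivPi L) : ℝ) : ℂ) * I := by
    have h := sub_conj (z * conj w)
    simp only [map_mul, conj_conj] at h
    rw [h]
    push_cast
    ring
  rw [this, re_ofReal_mul, I_re, mul_zero, Real.exp_zero]

lemma covolume_lattice : ZLattice.covolume L.lattice = |(L.ω₁ * conj L.ω₂).im| := by
  have hv : MeasureTheory.volume.real (ZSpan.fundamentalDomain basisOneI) = 1 := by
    rw [← toBasis_orthonormalBasisOneI, MeasureTheory.measureReal_def,
      MeasureTheory.measure_congr (ZSpan.fundamentalDomain_ae_parallelepiped _ _),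
      OrthonormalBasis.coe_toBasis, OrthonormalBasis.volume_parallelepiped, ENNReal.toReal_one]
  have h := ZLattice.covolume_eq_det_mul_measureReal L.lattice MeasureTheory.volume L.latticeBasis
    basisOneI
  rw [h, hv, mul_one,
    Module.Basis.det_apply, Matrix.det_fin_two, ← abs_neg]
  congr 1
  simp [Module.Basis.toMatrix_apply]
  ring

/-- The alternating form `Im (γ γ̄')` takes values in the integral multiples of the covolume. -/
lemma weil_sq_lattice {γ γ' : ℂ} (h : γ ∈ L.lattice) (h' : γ' ∈ L.lattice) :
    weil L γ γ' ^ 2 = 1 := by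
  obtain ⟨m, n, rfl⟩ := PeriodPair.mem_lattice.1 h
  obtain ⟨m', n', rfl⟩ := PeriodPair.mem_lattice.1 h'
  have hv : ZLattice.covolume L.lattice ≠ 0 := ZLattice.covolume_ne_zero _ _
  obtain ⟨k, hk⟩ : ∃ k : ℤ, ((L.ω₁ * conj L.ω₂).im : ℝ) = k * ZLattice.covolume L.lattice := by
    rw [covolume_lattice]
    rcases abs_choice (L.ω₁ * conj L.ω₂).im with h | h
    · exact ⟨1, by rw [h]; simp⟩
    · exact ⟨-1, by rw [h]; simp⟩
  have hsub : L.ω₁ * conj L.ω₂ - conj L.ω₁ * L.ω₂ =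
      2 * (k * (ZLattice.covolume L.lattice : ℂ)) * I := by
    have h := sub_conj (L.ω₁ * conj L.ω₂)
    simp only [map_mul, conj_conj] at h
    rw [h, hk]
    push_cast
    ring
  have hv' : (ZLattice.covolume L.lattice : ℂ) ≠ 0 := ofReal_ne_zero.2 hv
  have hpi : (Real.pi : ℂ) ≠ 0 := ofReal_ne_zero.2 Real.pi_ne_zero
  rw [weil, ← Complex.exp_nat_mul, Complex.exp_eq_one_iff]
  refine ⟨(m * n' - n * m') * k, ?_⟩
  simp only [map_add, map_mul, map_intCast, areaDivPi]
  push_cast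
  field_simp
  linear_combination (m * n' - n * m' : ℂ) * hsub

/-- The normalization `φ(z) = θ(z) exp (-|z|² / (2A))` of the reduced theta function, whose
absolute value is periodic. -/
def normTheta (z : ℂ) : ℂ := theta L z * exp (-(z * conj z) / (2 * areaDivPi L))

lemma continuous_normTheta : Continuous (normTheta L) := by
  have := (differentiable_theta L).continuous
  unfold normTheta
  fun_prop

lemma normTheta_eq_zero_iff {z : ℂ} : normTheta L z = 0 ↔ z ∈ L.lattice := by
  simp [normTheta, exp_ne_zero, theta_eq_zero_iff]

lemma normTheta_add_generator {ω : ℂ} (hω : IsGenerator L ω) (hmem : ω ∈ L.lattice)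
    (h2 : ω / 2 ∉ L.lattice) (z : ℂ) :
    normTheta L (z + ω) = -1 * weil L z ω * normTheta L z := by
  rw [normTheta, normTheta, theta_add_generator L hω hmem h2, weil]
  have h := areaDivPi_ne_zero L
  have e1 : exp (conj ω * (z + ω / 2) / areaDivPi L) *
      exp (-((z + ω) * conj (z + ω)) / (2 * areaDivPi L)) =
      exp ((z * conj ω - conj z * ω) / (2 * areaDivPi L)) *
        exp (-(z * conj z) / (2 * areaDivPi L)) := by
    rw [← Complex.exp_add, ← Complex.exp_add, map_add]
    congr 1
    field_simp
    ring
  linear_combination -(theta L z) * e1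

/-- The periods `γ` for which `φ(z + γ) = ±E(z, γ) φ(z)` form a group. -/
def signPeriods : AddSubgroup ℂ where
  carrier := {γ | γ ∈ L.lattice ∧ ∃ ε : ℂ, ε ^ 2 = 1 ∧
    ∀ z, normTheta L (z + γ) = ε * weil L z γ * normTheta L z}
  zero_mem' := ⟨zero_mem _, 1, by simp, fun z => by simp [weil_zero_right]⟩
  add_mem' := by
    rintro a b ⟨ha, ε, hε, h⟩ ⟨hb, ε', hε', h'⟩
    refine ⟨add_mem ha hb, ε * ε' * weil L a b, ?_, fun z => ?_⟩
    · rw [mul_pow, mul_pow, hε, hε', weil_sq_lattice L ha hb]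
      ring
    · rw [← add_assoc, h', h, weil_add_left, weil_add_right]
      ring
  neg_mem' := by
    rintro a ⟨ha, ε, hε, h⟩
    refine ⟨neg_mem ha, ε, hε, fun z => ?_⟩
    have h1 := h (z + -a)
    rw [neg_add_cancel_right] at h1
    have h2 : weil L (z + -a) a * weil L z (-a) = 1 := by
      have h3 : weil L (-a) a = 1 := by simp [weil, mul_comm]
      rw [weil_add_left, h3, mul_one, ← weil_add_right, add_neg_cancel, weil_zero_right]
    rw [h1]
    linear_combination -(normTheta L (z + -a)) * hε -
      ε ^ 2 * normTheta L (z + -a) * h2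

/-- The exact multipliers of `φ`. They form a group by `signPeriods`, so it suffices to treat the
basis of the lattice. -/
lemma normTheta_add_lattice {γ : ℂ} (hγ : γ ∈ L.lattice) : ∃ ε : ℂ, ε ^ 2 = 1 ∧
    ∀ z, normTheta L (z + γ) = ε * weil L z γ * normTheta L z := by
  have hle : L.lattice ≤ (signPeriods L).toIntSubmodule := by
    refine Submodule.span_le.2 ?_
    rintro x (rfl | rfl)
    · exact ⟨L.ω₁_mem_lattice, -1, by norm_num, normTheta_add_generator L (isGenerator_ω₁ L)
        L.ω₁_mem_lattice L.ω₁_div_two_notMem_lattice⟩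
    · exact ⟨L.ω₂_mem_lattice, -1, by norm_num, normTheta_add_generator L (isGenerator_ω₂ L)
        L.ω₂_mem_lattice L.ω₂_div_two_notMem_lattice⟩
  exact (hle hγ).2

lemma norm_normTheta_add_lattice {γ : ℂ} (hγ : γ ∈ L.lattice) (z : ℂ) :
    ‖normTheta L (z + γ)‖ = ‖normTheta L z‖ := by
  obtain ⟨ε, hε, h⟩ := normTheta_add_lattice L hγ
  have h1 : ‖ε‖ = 1 := by
    have := congrArg norm hε
    rw [norm_pow, norm_one] at this
    exact (pow_eq_one_iff_of_nonneg (norm_nonneg _) two_ne_zero).1 this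
  rw [h, norm_mul, norm_mul, h1, norm_weil, one_mul, one_mul]

/-- The Heisenberg translate `(T_a φ)(z) = E(a, z) φ(z + a)`, which agrees with `θ_a(z)` up to the
factor `exp (|z|² / (2A))`. -/
def heisTheta (a z : ℂ) : ℂ := weil L a z * normTheta L (z + a)

lemma thetaAt_eq (a z : ℂ) :
    thetaAt L a z = exp (z * conj z / (2 * areaDivPi L)) * heisTheta L a z := by
  have h := areaDivPi_ne_zero L
  have e1 : exp (-(z * conj a) / areaDivPi L - a * conj a / (2 * areaDivPi L)) =
      exp (z * conj z / (2 * areaDivPi L)) * (exp ((a * conj z - conj a * z) / (2 * areaDivPi L)) *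
        exp (-((z + a) * conj (z + a)) / (2 * areaDivPi L))) := by
    rw [← Complex.exp_add, ← Complex.exp_add, map_add]
    congr 1
    field_simp
    ring
  rw [thetaAt, heisTheta, weil, normTheta, e1]
  ring

lemma heisTheta_eq_zero_iff {a z : ℂ} : heisTheta L a z = 0 ↔ z + a ∈ L.lattice := by
  simp [heisTheta, weil_ne_zero, normTheta_eq_zero_iff]

lemma norm_heisTheta (a z : ℂ) : ‖heisTheta L a z‖ = ‖normTheta L (z + a)‖ := by
  rw [heisTheta, norm_mul, norm_weil, one_mul]

/-- The values `E(a, γ)` at torsion points `a` and periods `γ` are roots of unity. -/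
lemma weil_pow_eq_one {a γ : ℂ} {n : ℕ} (ha : (n : ℂ) * a ∈ L.lattice) (hγ : γ ∈ L.lattice) :
    weil L a γ ^ (2 * n) = 1 := by
  rw [mul_comm, pow_mul, ← weil_nat_mul_left, weil_sq_lattice L ha hγ]

/-- A suitable power of `T_a φ` only depends on the torsion point represented by `a`. -/
lemma heisTheta_pow_congr {a b : ℂ} {n : ℕ} (ha : (n : ℂ) * a ∈ L.lattice)
    (hab : b - a ∈ L.lattice) (z : ℂ) :
    heisTheta L b z ^ (2 * n) = heisTheta L a z ^ (2 * n) := by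
  obtain ⟨ε, hε, h⟩ := normTheta_add_lattice L hab
  have hb : b = a + (b - a) := by ring
  have e1 : heisTheta L b z = ε * weil L a (b - a) * heisTheta L a z := by
    have h1 : weil L (b - a) z * weil L z (b - a) = 1 := by
      rw [weil_swap, inv_mul_cancel₀ (weil_ne_zero _ _ _)]
    have h2 : weil L b z = weil L a z * weil L (b - a) z := by rw [← weil_add_left, ← hb]
    have h3 : normTheta L (z + b) = ε * weil L (z + a) (b - a) * normTheta L (z + a) := by
      rw [← h, ← add_sub_assoc, add_right_comm, add_sub_cancel_right]
    rw [heisTheta, heisTheta, h2, h3, weil_add_left]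
    linear_combination ε * weil L a (b - a) * weil L a z * normTheta L (z + a) * h1
  rw [e1, mul_pow, mul_pow, pow_mul, hε, one_pow, weil_pow_eq_one L ha hab, one_mul, one_mul]

/-! ### Liouville's theorem for quotients of theta functions -/

/-- A function holomorphic off the lattice, with periodic absolute value and with `o(1/z)` growth
at the origin, is constant. -/
lemma exists_eq_const_of_norm_periodic {q : ℂ → ℂ}
    (hd : ∀ z ∉ L.lattice, DifferentiableAt ℂ q z)
    (hp : ∀ z ∉ L.lattice, ∀ γ ∈ L.lattice, ‖q (z + γ)‖ = ‖q z‖)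
    (h0 : Tendsto (fun z => z * q z) (𝓝[≠] 0) (𝓝 0)) : ∃ c, ∀ z ∉ L.lattice, q z = c := by
  classical
  -- The extension of `q` over its removable singularities.
  set Q : ℂ → ℂ := fun z => if z ∈ L.lattice then limUnder (𝓝[≠] z) q else q z with hQ
  have hQq : ∀ z ∉ L.lattice, Q z = q z := fun z hz => if_neg hz
  have hopen : IsOpen ((L.lattice : Set ℂ)ᶜ) := L.isClosed_lattice.isOpen_compl
  have hQd : Differentiable ℂ Q := by
    intro c
    by_cases hc : c ∈ L.lattice
    · have hs : ((L.lattice : Set ℂ) \ {c})ᶜ ∈ 𝓝 c := L.compl_lattice_sdiff_singleton_mem_nhds c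
      have hmem : ∀ z ∈ ((L.lattice : Set ℂ) \ {c})ᶜ, z ≠ c → z ∉ L.lattice := by
        intro z hz hzc h
        exact hz ⟨h, hzc⟩
      have hlim : Tendsto (fun z => (z - c) * q z) (𝓝[≠] c) (𝓝 0) := by
        rw [tendsto_zero_iff_norm_tendsto_zero] at h0 ⊢
        have hsub : Tendsto (fun z => z - c) (𝓝[≠] c) (𝓝[≠] 0) := by
          refine tendsto_nhdsWithin_iff.2 ⟨?_, ?_⟩
          · refine tendsto_nhdsWithin_of_tendsto_nhds ?_
            have : ContinuousAt (fun z : ℂ => z - c) c := by fun_prop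
            simpa [ContinuousAt] using this
          · filter_upwards [self_mem_nhdsWithin] with z hz
            exact sub_ne_zero.2 hz
        refine (h0.comp hsub).congr' ?_
        filter_upwards [nhdsWithin_le_nhds hs, self_mem_nhdsWithin] with z hz hzc
        have hz' := hmem z hz hzc
        have hzc' : z - c ∉ L.lattice := fun h => hz' (by simpa using add_mem h hc)
        simp only [Function.comp_apply, norm_mul]
        rw [← hp _ hzc' c hc, sub_add_cancel]
      have hlo : (fun z => q z - q c) =o[𝓝[≠] c] fun z => (z - c)⁻¹ := by
        rw [Asymptotics.isLittleO_iff_tendsto']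
        · have h1 : Tendsto (fun z => (z - c) * q c) (𝓝[≠] c) (𝓝 0) := by
            refine tendsto_nhdsWithin_of_tendsto_nhds ?_
            have : ContinuousAt (fun z : ℂ => (z - c) * q c) c := by fun_prop
            simpa [ContinuousAt] using this
          have := hlim.sub h1
          rw [sub_zero] at this
          refine this.congr fun z => ?_
          rw [div_inv_eq_mul]
          ring
        · filter_upwards [self_mem_nhdsWithin] with z hz h
          exact absurd (inv_eq_zero.1 h) (sub_ne_zero.2 hz)
      have hu := differentiableOn_update_limUnder_of_isLittleO hs
        (fun z hz => (hd z (hmem z hz.1 hz.2)).differentiableWithinAt) hlo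
      have hQu : ∀ z ∈ ((L.lattice : Set ℂ) \ {c})ᶜ,
          Q z = Function.update q c (limUnder (𝓝[≠] c) q) z := by
        intro z hz
        by_cases hzc : z = c
        · subst hzc
          simp [hQ, hc]
        · rw [Function.update_of_ne hzc, hQq z (hmem z hz hzc)]
      exact (hu.congr hQu).differentiableAt hs
    · refine (hd c hc).congr_of_eventuallyEq ?_
      filter_upwards [hopen.mem_nhds hc] with z hz
      exact hQq z hz
  have hper : ∀ z γ, γ ∈ L.lattice → ‖Q (z + γ)‖ = ‖Q z‖ := by
    intro z γ hγ
    have hcont := hQd.continuous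
    refine congrFun (Continuous.ext_on (dense_compl_lattice L) (f := fun z => ‖Q (z + γ)‖)
      (g := fun z => ‖Q z‖) (by fun_prop) (by fun_prop) fun z hz => ?_) z
    have hzγ : z + γ ∉ L.lattice := fun h => hz (by simpa using sub_mem h hγ)
    simp only
    rw [hQq z hz, hQq _ hzγ, hp z hz γ hγ]
  have hb := (IsZLattice.isCompact_range_of_periodic L.lattice (fun z => ‖Q z‖)
    hQd.continuous.norm hper).isBounded
  have hbQ : Bornology.IsBounded (Set.range Q) := by
    obtain ⟨C, hC⟩ := isBounded_iff_forall_norm_le.1 hb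
    refine isBounded_iff_forall_norm_le.2 ⟨C, ?_⟩
    rintro _ ⟨z, rfl⟩
    simpa using hC _ ⟨z, rfl⟩
  obtain ⟨c, hc⟩ := hQd.exists_const_forall_eq_of_bounded hbQ
  exact ⟨c, fun z hz => (hQq z hz).symm.trans (hc z)⟩

/-! ### Torsion points of the complex torus -/

/-- The period pair of the lattice `a⁻¹Γ`. -/
def divPeriod {a : ℂ} (ha : a ≠ 0) : PeriodPair where
  ω₁ := a⁻¹ * L.ω₁
  ω₂ := a⁻¹ * L.ω₂
  indep := by
    have h := L.indep
    rw [LinearIndependent.pair_iff] at h ⊢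
    intro s t hst
    refine h s t ?_
    have : a * (s • (a⁻¹ * L.ω₁) + t • (a⁻¹ * L.ω₂)) = 0 := by rw [hst, mul_zero]
    rw [← this]
    simp only [real_smul]
    field_simp

lemma mem_divPeriod {a : ℂ} (ha : a ≠ 0) {z : ℂ} :
    z ∈ (divPeriod L ha).lattice ↔ a * z ∈ L.lattice := by
  rw [PeriodPair.mem_lattice, PeriodPair.mem_lattice]
  refine exists₂_congr fun m n => ?_
  have h : (m * (divPeriod L ha).ω₁ + n * (divPeriod L ha).ω₂ : ℂ) =
      a⁻¹ * (m * L.ω₁ + n * L.ω₂) := by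
    simp only [divPeriod]
    ring
  rw [h, inv_mul_eq_iff_eq_mul₀ ha]

lemma covolume_divPeriod {a : ℂ} (ha : a ≠ 0) :
    ‖a‖ ^ 2 * ZLattice.covolume (divPeriod L ha).lattice = ZLattice.covolume L.lattice := by
  have h : (divPeriod L ha).ω₁ * conj (divPeriod L ha).ω₂ =
      (((‖a‖ ^ 2)⁻¹ : ℝ) : ℂ) * (L.ω₁ * conj L.ω₂) := by
    have h1 := mul_conj' a
    have h2 : conj a ≠ 0 := by simpa using ha
    push_cast
    rw [← h1]
    simp only [divPeriod, map_mul, map_inv₀]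
    field_simp
  have hn : ‖a‖ ≠ 0 := norm_ne_zero_iff.2 ha
  rw [covolume_lattice, covolume_lattice, h, im_ofReal_mul, abs_mul, abs_of_nonneg (by positivity)]
  field_simp

/-- Multiplication by `a` maps the lattice into itself. -/
def IsMultiplier (a : ℂ) : Prop := ∀ γ ∈ L.lattice, a * γ ∈ L.lattice

variable {L} in
lemma IsMultiplier.mul {a b : ℂ} (ha : IsMultiplier L a) (hb : IsMultiplier L b) :
    IsMultiplier L (a * b) := fun γ hγ => by
  rw [mul_assoc]
  exact ha _ (hb _ hγ)

lemma natCast_mul_mem {z : ℂ} (n : ℕ) (hz : z ∈ L.lattice) : (n : ℂ) * z ∈ L.lattice := by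
  rw [← nsmul_eq_mul]
  exact nsmul_mem hz n

lemma isMultiplier_natCast (n : ℕ) : IsMultiplier L n := fun _ hγ => natCast_mul_mem L n hγ

/-- The group `E[a]` of points of `ℂ/Γ` killed by `a`. -/
def torsionSubgroup (a : ℂ) : AddSubgroup (Torus L) :=
  (L.lattice.toAddSubgroup.comap (AddMonoidHom.mulLeft a)).map L.lattice.mkQ.toAddMonoidHom

lemma coe_torsionSubgroup (a : ℂ) : (torsionSubgroup L a : Set (Torus L)) = torsionPoints L a := by
  ext P
  simp [torsionSubgroup, torsionPoints, and_comm]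

lemma mkQ_eq_iff {z w : ℂ} : L.lattice.mkQ z = L.lattice.mkQ w ↔ z - w ∈ L.lattice := by
  simp [Submodule.Quotient.eq]

variable {L} in
lemma IsMultiplier.mkQ_mem {a : ℂ} (ha : IsMultiplier L a) {z : ℂ} :
    L.lattice.mkQ z ∈ torsionSubgroup L a ↔ a * z ∈ L.lattice := by
  constructor
  · rintro ⟨w, hw, hwz⟩
    have h1 : w - z ∈ L.lattice := (mkQ_eq_iff L).1 hwz
    have h2 : a * w ∈ L.lattice := hw
    have := sub_mem h2 (ha _ h1)
    rwa [mul_sub, sub_sub_cancel] at this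
  · exact fun h => ⟨z, h, rfl⟩

/-- A choice of representatives in `ℂ` of the points of `ℂ/Γ`. -/
def torusLift (P : Torus L) : ℂ := Function.surjInv L.lattice.mkQ_surjective P

@[simp] lemma mkQ_torusLift (P : Torus L) : L.lattice.mkQ (torusLift L P) = P :=
  Function.surjInv_eq _ P

variable {L} in
lemma IsMultiplier.mul_torusLift_mem {a : ℂ} (ha : IsMultiplier L a) (P : torsionSubgroup L a) :
    a * torusLift L P ∈ L.lattice := by
  rw [← ha.mkQ_mem, mkQ_torusLift]
  exact P.2

variable {L} in
/-- The group `E[a]` has order `|a|²`. -/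
lemma IsMultiplier.card_torsionSubgroup {a : ℂ} (ha : IsMultiplier L a) (h0 : a ≠ 0) :
    (Nat.card (torsionSubgroup L a) : ℝ) = ‖a‖ ^ 2 := by
  have hle : L.lattice ≤ (divPeriod L h0).lattice := fun γ hγ => (mem_divPeriod L h0).2 (ha γ hγ)
  have h1 := ZLattice.covolume_div_covolume_eq_relIndex' L.lattice (divPeriod L h0).lattice hle
  have h2 : (divPeriod L h0).lattice.toAddSubgroup =
      L.lattice.toAddSubgroup.comap (AddMonoidHom.mulLeft a) := by
    ext z
    exact mem_divPeriod L h0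
  have h3 : L.lattice.mkQ.toAddMonoidHom.ker = L.lattice.toAddSubgroup := by
    ext z
    simp [AddMonoidHom.mem_ker]
  have h4 : L.lattice.toAddSubgroup.relIndex (divPeriod L h0).lattice.toAddSubgroup =
      Nat.card (torsionSubgroup L a) := by
    rw [h2, torsionSubgroup]
    have h5 := AddSubgroup.relIndex_ker (K := L.lattice.toAddSubgroup.comap (AddMonoidHom.mulLeft a))
      L.lattice.mkQ.toAddMonoidHom
    rwa [h3] at h5
  rw [← h4, ← h1, ← covolume_divPeriod L h0, mul_div_assoc, div_self, mul_one]
  exact ZLattice.covolume_ne_zero _ _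

variable {L} in
lemma IsMultiplier.finite_torsionSubgroup {a : ℂ} (ha : IsMultiplier L a) (h0 : a ≠ 0) :
    Finite (torsionSubgroup L a) := by
  refine Nat.finite_of_card_ne_zero fun h => ?_
  have := ha.card_torsionSubgroup h0
  rw [h, Nat.cast_zero] at this
  exact h0 (norm_eq_zero.1 (pow_eq_zero_iff two_ne_zero |>.1 this.symm))

variable {L} in
lemma IsMultiplier.card_mul_mem {a : ℂ} (ha : IsMultiplier L a) {z : ℂ}
    (hz : a * z ∈ L.lattice) : (Nat.card (torsionSubgroup L a) : ℂ) * z ∈ L.lattice := by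
  have h1 : Nat.card (torsionSubgroup L a) • (⟨_, ha.mkQ_mem.2 hz⟩ : torsionSubgroup L a) = 0 :=
    card_nsmul_eq_zero'
  have h2 := congrArg Subtype.val h1
  simp only [AddSubgroup.coe_nsmul, ZeroMemClass.coe_zero] at h2
  rw [← map_nsmul, Submodule.mkQ_apply, Submodule.Quotient.mk_eq_zero, nsmul_eq_mul] at h2
  exact h2

lemma torusLift_sub_mem (z : ℂ) : torusLift L (L.lattice.mkQ z) - z ∈ L.lattice := by
  rw [← mkQ_eq_iff, mkQ_torusLift]

/-! ### The distribution relation up to a constant -/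

/-- The periodic function `|φ|` on the torus. -/
def torusNorm (P : Torus L) : ℝ := ‖normTheta L (torusLift L P)‖

lemma torusNorm_mkQ (z : ℂ) : torusNorm L (L.lattice.mkQ z) = ‖normTheta L z‖ := by
  have h := norm_normTheta_add_lattice L (torusLift_sub_mem L z) z
  rw [add_sub_cancel] at h
  exact h

lemma norm_heisTheta_torusLift (z : ℂ) (P : Torus L) :
    ‖heisTheta L (torusLift L P) z‖ = torusNorm L (L.lattice.mkQ z + P) := by
  rw [norm_heisTheta, ← torusNorm_mkQ, map_add, mkQ_torusLift]

lemma differentiable_thetaAt (a : ℂ) : Differentiable ℂ (thetaAt L a) := by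
  have := differentiable_theta L
  unfold thetaAt
  fun_prop

lemma theta_eq_normTheta (z : ℂ) :
    theta L z = exp (z * conj z / (2 * areaDivPi L)) * normTheta L z := by
  rw [normTheta, mul_left_comm, ← Complex.exp_add, neg_div, add_neg_cancel, Complex.exp_zero,
    mul_one]

lemma tendsto_normTheta_mul_div (c : ℂ) :
    Tendsto (fun z => normTheta L (c * z) / z) (𝓝[≠] 0) (𝓝 c) := by
  have h1 : HasDerivAt (fun z => theta L (c * z)) c 0 := by
    have h2 : HasDerivAt (theta L) 1 (c * 0) := by
      rw [mul_zero]
      exact hasDerivAt_theta_zero L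
    have := h2.comp (0 : ℂ) ((hasDerivAt_id' (0 : ℂ)).const_mul c)
    simpa [Function.comp_def] using this
  have h3 := hasDerivAt_iff_tendsto_slope_zero.1 h1
  have h4 : Tendsto (fun z : ℂ => exp (-(c * z * conj (c * z)) / (2 * areaDivPi L))) (𝓝[≠] 0)
      (𝓝 1) := by
    refine tendsto_nhdsWithin_of_tendsto_nhds ?_
    have : ContinuousAt (fun z : ℂ => exp (-(c * z * conj (c * z)) / (2 * areaDivPi L))) 0 := by
      fun_prop
    simpa [ContinuousAt] using this
  have h5 := h3.mul h4
  rw [mul_one] at h5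
  refine h5.congr fun z => ?_
  simp only [zero_add, mul_zero, theta_zero, sub_zero, smul_eq_mul, normTheta]
  ring

variable {L} in
/-- The distribution relation up to a constant, which `IsDistributionConst.pow_eq` determines up to
roots of unity. Both sides have the same zeros, and their absolute values are invariant under the
same lattice `a⁻¹Γ`; the Gaussian factors cancel because `E[a]` has `|a|²` elements. -/
lemma IsMultiplier.exists_normTheta_mul_eq {a : ℂ} (ha : IsMultiplier L a) (h0 : a ≠ 0)
    [Fintype (torsionSubgroup L a)] :
    ∃ κ : ℂ, κ ≠ 0 ∧
      ∀ z, normTheta L (a * z) = κ * ∏ P : torsionSubgroup L a, heisTheta L (torusLift L P) z := by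
  classical
  set q : ℂ → ℂ := fun z =>
    theta L (a * z) / ∏ P : torsionSubgroup L a, thetaAt L (torusLift L P) z with hq
  have hqn : ∀ z, q z = normTheta L (a * z) /
      ∏ P : torsionSubgroup L a, heisTheta L (torusLift L P) z := by
    intro z
    have h1 : exp (a * z * conj (a * z) / (2 * areaDivPi L)) =
        exp (z * conj z / (2 * areaDivPi L)) ^ Fintype.card (torsionSubgroup L a) := by
      rw [← Complex.exp_nat_mul]
      congr 1
      have h2 := ha.card_torsionSubgroup h0
      rw [Nat.card_eq_fintype_card] at h2
      have h3 : ((Fintype.card (torsionSubgroup L a) : ℕ) : ℂ) = a * conj a := by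
        rw [mul_conj']
        exact_mod_cast h2
      rw [h3, map_mul]
      ring
    simp only [hq, thetaAt_eq, theta_eq_normTheta L (a * z), Finset.prod_mul_distrib,
      Finset.prod_const, Finset.card_univ]
    rw [h1, mul_div_mul_left]
    exact pow_ne_zero _ (Complex.exp_ne_zero _)
  have hzero : ∀ z, (∏ P : torsionSubgroup L a, heisTheta L (torusLift L P) z) = 0 ↔
      a * z ∈ L.lattice := by
    intro z
    rw [Finset.prod_eq_zero_iff]
    simp only [Finset.mem_univ, true_and, heisTheta_eq_zero_iff]
    constructor
    · rintro ⟨P, hP⟩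
      have := sub_mem (ha _ hP) (ha.mul_torusLift_mem P)
      rwa [mul_add, add_sub_cancel_right] at this
    · intro h
      refine ⟨-⟨_, ha.mkQ_mem.2 h⟩, ?_⟩
      rw [← Submodule.Quotient.mk_eq_zero, ← Submodule.mkQ_apply, map_add, mkQ_torusLift]
      simp
  have hthz : ∀ z, (∏ P : torsionSubgroup L a, thetaAt L (torusLift L P) z) = 0 →
      a * z ∈ L.lattice := by
    intro z h
    rw [← hzero z]
    simp only [thetaAt_eq, Finset.prod_mul_distrib] at h
    refine (mul_eq_zero.1 h).resolve_left ?_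
    exact Finset.prod_ne_zero_iff.2 fun _ _ => Complex.exp_ne_zero _
  -- The periods in `a⁻¹Γ` permute the factors of the denominator up to absolute value one.
  have hqnorm : ∀ z, ‖q z‖ = torusNorm L (L.lattice.mkQ (a * z)) /
      ∏ P : torsionSubgroup L a, torusNorm L (L.lattice.mkQ z + P) := by
    intro z
    rw [hqn, norm_div, norm_prod, torusNorm_mkQ]
    simp only [norm_heisTheta_torusLift]
  have hd : ∀ z ∉ (divPeriod L h0).lattice, DifferentiableAt ℂ q z := by
    intro z hz
    have hd1 := differentiable_theta L
    have hd2 : Differentiable ℂ fun z => theta L (a * z) := by fun_prop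
    have hd3 : Differentiable ℂ
        fun z => ∏ P : torsionSubgroup L a, thetaAt L (torusLift L P) z :=
      Differentiable.fun_finsetProd fun P _ => differentiable_thetaAt L _
    exact (hd2 z).fun_div (hd3 z) fun h => hz ((mem_divPeriod L h0).2 (hthz z h))
  have hper : ∀ z ∉ (divPeriod L h0).lattice, ∀ w ∈ (divPeriod L h0).lattice,
      ‖q (z + w)‖ = ‖q z‖ := by
    intro z _ w hw
    have hw' := (mem_divPeriod L h0).1 hw
    rw [hqnorm, hqnorm, mul_add]
    have e1 : L.lattice.mkQ (a * z + a * w) = L.lattice.mkQ (a * z) := by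
      rw [mkQ_eq_iff, add_sub_cancel_left]
      exact hw'
    rw [e1]
    congr 1
    rw [← Equiv.prod_comp (Equiv.addLeft (⟨_, ha.mkQ_mem.2 hw'⟩ : torsionSubgroup L a))
      (fun P : torsionSubgroup L a => torusNorm L (L.lattice.mkQ z + (P : Torus L)))]
    refine Finset.prod_congr rfl fun P _ => ?_
    rw [map_add]
    simp [add_assoc]
  have hlim : Tendsto (fun z => z * q z) (𝓝[≠] 0) (𝓝 0) := by
    rw [tendsto_zero_iff_norm_tendsto_zero]
    have hcont := continuous_normTheta L
    have h1 := (tendsto_normTheta_mul_div L 1).norm.inv₀ (by simp)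
    have h2 : Tendsto (fun z => ‖normTheta L (a * z)‖) (𝓝[≠] 0) (𝓝 0) := by
      refine tendsto_nhdsWithin_of_tendsto_nhds ?_
      have : ContinuousAt (fun z => ‖normTheta L (a * z)‖) 0 := by fun_prop
      have h00 : normTheta L 0 = 0 := (normTheta_eq_zero_iff L).2 (zero_mem _)
      simpa [ContinuousAt, h00] using this
    -- Only the factor at the origin of `E[a]` vanishes at `0`, and it does so to first order.
    set R : ℂ → ℝ := fun z => ∏ P ∈ Finset.univ.erase (0 : torsionSubgroup L a),
      ‖normTheta L (z + torusLift L P)‖ with hR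
    have hR0 : R 0 ≠ 0 := by
      rw [hR]
      refine Finset.prod_ne_zero_iff.2 fun P hP => ?_
      rw [zero_add, norm_ne_zero_iff, ne_eq, normTheta_eq_zero_iff,
        ← Submodule.Quotient.mk_eq_zero, ← Submodule.mkQ_apply, mkQ_torusLift]
      simpa using Finset.ne_of_mem_erase hP
    have h3 : Tendsto R (𝓝[≠] 0) (𝓝 (R 0)) := by
      refine tendsto_nhdsWithin_of_tendsto_nhds ?_
      have : Continuous R := by fun_prop
      exact this.continuousAt
    have h4 := (h2.mul h1).div h3 hR0
    rw [zero_mul, zero_div] at h4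
    refine h4.congr fun z => ?_
    have h5 : ∏ P : torsionSubgroup L a, torusNorm L (L.lattice.mkQ z + P) =
        ‖normTheta L z‖ * R z := by
      rw [← Finset.mul_prod_erase Finset.univ _ (Finset.mem_univ 0)]
      congr 1
      · rw [ZeroMemClass.coe_zero, add_zero, torusNorm_mkQ]
      · refine Finset.prod_congr rfl fun P _ => ?_
        rw [← torusNorm_mkQ, map_add, mkQ_torusLift]
    rw [norm_mul, hqnorm, h5, torusNorm_mkQ]
    simp only [Pi.div_apply, one_mul, norm_div, inv_div]
    ring
  obtain ⟨κ, hκ⟩ := exists_eq_const_of_norm_periodic (divPeriod L h0) (q := q) hd hper hlim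
  have hne : ∃ z, z ∉ (divPeriod L h0).lattice :=
    ⟨_, (divPeriod L h0).ω₁_div_two_notMem_lattice⟩
  have hmain : ∀ z, normTheta L (a * z) =
      κ * ∏ P : torsionSubgroup L a, heisTheta L (torusLift L P) z := by
    intro z
    by_cases hz : a * z ∈ L.lattice
    · rw [(hzero z).2 hz, mul_zero, normTheta_eq_zero_iff]
      exact hz
    · have h1 := hκ z (fun h => hz ((mem_divPeriod L h0).1 h))
      rw [hqn, div_eq_iff (fun h => hz ((hzero z).1 h))] at h1
      exact h1
  refine ⟨κ, ?_, hmain⟩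
  rintro rfl
  obtain ⟨z, hz⟩ := hne
  have := hmain z
  rw [zero_mul, normTheta_eq_zero_iff] at this
  exact hz ((mem_divPeriod L h0).2 this)

/-! ### Multiplicativity of the constants -/

/-- `κ` is the constant of the distribution relation for multiplication by `a`, formed with the
lifts `torusLift`. -/
def IsDistributionConst (a κ : ℂ) : Prop :=
  κ ≠ 0 ∧ ∀ z, normTheta L (a * z) =
    κ * ∏ᶠ P : torsionSubgroup L a, heisTheta L (torusLift L P) z

variable {L}

lemma IsMultiplier.exists_isDistributionConst {a : ℂ} (ha : IsMultiplier L a) (h0 : a ≠ 0) :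
    ∃ κ, IsDistributionConst L a κ := by
  have := ha.finite_torsionSubgroup h0
  have := Fintype.ofFinite (torsionSubgroup L a)
  obtain ⟨κ, h1, h2⟩ := ha.exists_normTheta_mul_eq h0
  exact ⟨κ, h1, fun z => by rw [h2, finprod_eq_prod_of_fintype]⟩

lemma IsMultiplier.card_eq_mul_conj {a : ℂ} (ha : IsMultiplier L a) (h0 : a ≠ 0) :
    (Nat.card (torsionSubgroup L a) : ℂ) = conj a * a := by
  rw [conj_mul']
  exact_mod_cast ha.card_torsionSubgroup h0

/-- The pairing of a point of `E[a]` with a point `s` such that `a s` is killed by `m` is a root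
of unity of order dividing `2 m |a|²`. -/
lemma IsMultiplier.weil_pow_eq_one {a : ℂ} (ha : IsMultiplier L a) (h0 : a ≠ 0) {s t : ℂ} {m : ℕ}
    (ht : a * t ∈ L.lattice) (hs : (m : ℂ) * (a * s) ∈ L.lattice) :
    weil L t s ^ (2 * (Nat.card (torsionSubgroup L a) * m)) = 1 := by
  have h1 : weil L t s ^ Nat.card (torsionSubgroup L a) = weil L (a * t) (a * s) := by
    rw [← weil_nat_mul_left, ha.card_eq_mul_conj h0, mul_assoc, weil_mul_left, conj_conj]
  rw [mul_left_comm, pow_mul, h1, weil_swap, inv_pow, KroneckerTheta.weil_pow_eq_one L hs ht,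
    inv_one]

/-- The distribution relation for the translates of `φ`. -/
lemma IsDistributionConst.heisTheta_mul {a κ : ℂ} (h : IsDistributionConst L a κ)
    (ha : IsMultiplier L a) (h0 : a ≠ 0) [Fintype (torsionSubgroup L a)] (s z : ℂ) :
    heisTheta L (a * s) (a * z) = κ * ∏ P : torsionSubgroup L a,
      weil L (torusLift L P) s * heisTheta L (s + torusLift L P) z := by
  have h1 : weil L (a * s) (a * z) = weil L s z ^ Fintype.card (torsionSubgroup L a) := by
    rw [weil_mul_left, ← mul_assoc, ← ha.card_eq_mul_conj h0, weil_swap, weil_nat_mul_left,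
      weil_swap, inv_pow, inv_inv, Nat.card_eq_fintype_card]
  rw [heisTheta, h1, ← mul_add, h.2, finprod_eq_prod_of_fintype, mul_left_comm, ← Finset.card_univ,
    ← Finset.prod_const, ← Finset.prod_mul_distrib]
  congr 1
  refine Finset.prod_congr rfl fun P _ => ?_
  rw [heisTheta, heisTheta, weil_add_left, weil_add_right]
  have : z + s + torusLift L P = z + (s + torusLift L P) := by ring
  rw [this]
  ring

lemma IsMultiplier.card_torsionSubgroup_mul {a b : ℂ} (ha : IsMultiplier L a)
    (hb : IsMultiplier L b) (ha0 : a ≠ 0) (hb0 : b ≠ 0) :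
    Nat.card (torsionSubgroup L (a * b)) =
      Nat.card (torsionSubgroup L a) * Nat.card (torsionSubgroup L b) := by
  have h1 := (ha.mul hb).card_torsionSubgroup (mul_ne_zero ha0 hb0)
  rw [norm_mul, mul_pow, ← ha.card_torsionSubgroup ha0, ← hb.card_torsionSubgroup hb0] at h1
  exact_mod_cast h1

/-- The points of `E[ab]` are the sums `s/a + t` with `s` in `E[b]` and `t` in `E[a]`. -/
def torsionSum {a b : ℂ} (ha : IsMultiplier L a) (hb : IsMultiplier L b) (ha0 : a ≠ 0)
    (p : torsionSubgroup L b × torsionSubgroup L a) : torsionSubgroup L (a * b) :=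
  ⟨L.lattice.mkQ (a⁻¹ * torusLift L p.1 + torusLift L p.2), by
    rw [(ha.mul hb).mkQ_mem, mul_add]
    refine add_mem ?_ ?_
    · have := hb.mul_torusLift_mem p.1
      convert this using 1
      field_simp
    · rw [mul_comm a b, mul_assoc]
      exact hb _ (ha.mul_torusLift_mem p.2)⟩

lemma bijective_torsionSum {a b : ℂ} (ha : IsMultiplier L a) (hb : IsMultiplier L b) (ha0 : a ≠ 0)
    (hb0 : b ≠ 0) : Function.Bijective (torsionSum ha hb ha0) := by
  have := ha.finite_torsionSubgroup ha0
  have := hb.finite_torsionSubgroup hb0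
  have := (ha.mul hb).finite_torsionSubgroup (mul_ne_zero ha0 hb0)
  refine Function.Injective.bijective_of_nat_card_le ?_ ?_
  · rintro ⟨s, t⟩ ⟨s', t'⟩ h
    have h1 : a⁻¹ * torusLift L s + torusLift L t - (a⁻¹ * torusLift L s' + torusLift L t') ∈
        L.lattice := (mkQ_eq_iff L).1 (congrArg Subtype.val h)
    have hs : s = s' := by
      have h2 := sub_mem (ha _ h1)
        (sub_mem (ha.mul_torusLift_mem t) (ha.mul_torusLift_mem t'))
      have h3 : torusLift L s - torusLift L s' ∈ L.lattice := by
        convert h2 using 1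
        field_simp
        ring
      have h4 := (mkQ_eq_iff L).2 h3
      rw [mkQ_torusLift, mkQ_torusLift] at h4
      exact Subtype.ext h4
    subst hs
    have h5 : torusLift L t - torusLift L t' ∈ L.lattice := by
      convert h1 using 1
      ring
    have h6 := (mkQ_eq_iff L).2 h5
    rw [mkQ_torusLift, mkQ_torusLift] at h6
    rw [Subtype.ext h6]
  · rw [Nat.card_prod, ha.card_torsionSubgroup_mul hb ha0 hb0, mul_comm]

/-- Up to a root of unity, the constant for `ab` is the product of the one for `b` with a power of
the one for `a`. -/
lemma IsDistributionConst.pow_eq_mul {a b κa κb κ : ℂ} (ha : IsMultiplier L a)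
    (hb : IsMultiplier L b) (ha0 : a ≠ 0) (hb0 : b ≠ 0) (hκa : IsDistributionConst L a κa)
    (hκb : IsDistributionConst L b κb) (hκ : IsDistributionConst L (a * b) κ) {M : ℕ}
    (hM : M = 2 * (Nat.card (torsionSubgroup L a) * Nat.card (torsionSubgroup L b))) :
    κ ^ M = κb ^ M * (κa ^ M) ^ Nat.card (torsionSubgroup L b) := by
  have hab := ha.mul hb
  have hab0 := mul_ne_zero ha0 hb0
  have := ha.finite_torsionSubgroup ha0
  have := hb.finite_torsionSubgroup hb0
  have := hab.finite_torsionSubgroup hab0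
  have := Fintype.ofFinite (torsionSubgroup L a)
  have := Fintype.ofFinite (torsionSubgroup L b)
  have := Fintype.ofFinite (torsionSubgroup L (a * b))
  have hM' : M = 2 * Nat.card (torsionSubgroup L (a * b)) := by
    rw [hM, ha.card_torsionSubgroup_mul hb ha0 hb0]
  obtain ⟨z, hz⟩ : ∃ z, a * b * z ∉ L.lattice := by
    refine ⟨(a * b)⁻¹ * (L.ω₁ / 2), ?_⟩
    rw [mul_inv_cancel_left₀ hab0]
    exact L.ω₁_div_two_notMem_lattice
  set X : ℂ := ∏ u : torsionSubgroup L (a * b), heisTheta L (torusLift L u) z ^ M with hX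
  have h1 : normTheta L (a * b * z) ^ M = κ ^ M * X := by
    rw [hκ.2, finprod_eq_prod_of_fintype, mul_pow, ← Finset.prod_pow]
  have hs : ∀ s : torsionSubgroup L b, heisTheta L (torusLift L s) (a * z) ^ M =
      κa ^ M * ∏ t : torsionSubgroup L a,
        heisTheta L (torusLift L (torsionSum ha hb ha0 (s, t))) z ^ M := by
    intro s
    have e1 : torusLift L s = a * (a⁻¹ * torusLift L s) := by rw [mul_inv_cancel_left₀ ha0]
    have e2 : heisTheta L (torusLift L s) (a * z) = _ :=
      (congrArg (fun x => heisTheta L x (a * z)) e1).trans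
        (hκa.heisTheta_mul ha ha0 (a⁻¹ * torusLift L s) z)
    rw [e2, mul_pow, ← Finset.prod_pow]
    congr 1
    refine Finset.prod_congr rfl fun t _ => ?_
    rw [mul_pow]
    have e3 : weil L (torusLift L t) (a⁻¹ * torusLift L s) ^ M = 1 := by
      rw [hM]
      refine ha.weil_pow_eq_one ha0 (ha.mul_torusLift_mem t) ?_
      rw [← e1]
      exact hb.card_mul_mem (hb.mul_torusLift_mem s)
    rw [e3, one_mul, hM', eq_comm]
    exact heisTheta_pow_congr L
      (hab.card_mul_mem (hab.mkQ_mem.1 (torsionSum ha hb ha0 (s, t)).2)) (torusLift_sub_mem L _) z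
  -- Apply the relation for `b` at `a * z`, and then the relation for `a` to each factor.
  have h2 : normTheta L (a * b * z) ^ M =
      κb ^ M * (κa ^ M) ^ Nat.card (torsionSubgroup L b) * X := by
    rw [mul_comm a b, mul_assoc, hκb.2, finprod_eq_prod_of_fintype, mul_pow, ← Finset.prod_pow]
    simp only [hs]
    rw [Finset.prod_mul_distrib, Finset.prod_const, Finset.card_univ, ← Nat.card_eq_fintype_card,
      ← Fintype.prod_prod_type', mul_assoc]
    congr 2
    exact (bijective_torsionSum ha hb ha0 hb0).prod_comp
      fun u => heisTheta L (torusLift L u) z ^ M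
  have hX0 : X ≠ 0 := by
    intro h
    rw [h, mul_zero] at h1
    exact hz ((normTheta_eq_zero_iff L).1 (pow_eq_zero_iff (by
      rw [hM']
      have : Nat.card (torsionSubgroup L (a * b)) ≠ 0 := Nat.card_pos.ne'
      omega) |>.1 h1))
  exact mul_right_cancel₀ hX0 (h1.symm.trans h2)

/-! ### The constant for multiplication by two and the discriminant -/

variable (L)

/-- In `φ(z + w) φ(z - w) / φ(z)²` the factors acquired under a period cancel. -/
lemma normTheta_mul_normTheta_periodic (z w : ℂ) {γ : ℂ} (hγ : γ ∈ L.lattice) :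
    normTheta L (z + γ + w) * normTheta L (z + γ - w) / normTheta L (z + γ) ^ 2 =
      normTheta L (z + w) * normTheta L (z - w) / normTheta L z ^ 2 := by
  obtain ⟨ε, hε, h⟩ := normTheta_add_lattice L hγ
  have hε0 : ε ≠ 0 := by
    rintro rfl
    norm_num at hε
  have hw : weil L (z + w) γ * weil L (z - w) γ = weil L z γ ^ 2 := by
    rw [← weil_add_left, show z + w + (z - w) = (2 : ℕ) * z by push_cast; ring, weil_nat_mul_left]
  rw [add_right_comm, show z + γ - w = z - w + γ by ring, h, h, h]
  have h1 : ε * weil L (z + w) γ * normTheta L (z + w) *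
      (ε * weil L (z - w) γ * normTheta L (z - w)) =
      (ε * weil L z γ) ^ 2 * (normTheta L (z + w) * normTheta L (z - w)) := by
    rw [mul_pow, ← hw]
    ring
  rw [h1, mul_pow _ (normTheta L z), mul_div_mul_left]
  exact pow_ne_zero _ (mul_ne_zero hε0 (weil_ne_zero _ _ _))

lemma theta_mul_theta_div (z w : ℂ) :
    theta L (z + w) * theta L (z - w) / theta L z ^ 2 = exp (w * conj w / areaDivPi L) *
      (normTheta L (z + w) * normTheta L (z - w) / normTheta L z ^ 2) := by
  have h := areaDivPi_ne_zero L
  rw [theta_eq_normTheta L (z + w), theta_eq_normTheta L (z - w), theta_eq_normTheta L z]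
  have e1 : exp ((z + w) * conj (z + w) / (2 * areaDivPi L)) *
      exp ((z - w) * conj (z - w) / (2 * areaDivPi L)) =
      exp (z * conj z / (2 * areaDivPi L)) ^ 2 * exp (w * conj w / areaDivPi L) := by
    rw [← Complex.exp_nat_mul, ← Complex.exp_add, ← Complex.exp_add, map_add, map_sub]
    congr 1
    push_cast
    field_simp
    ring
  have h2 := Complex.exp_ne_zero (z * conj z / (2 * areaDivPi L))
  rw [mul_mul_mul_comm, e1, mul_pow, mul_assoc, mul_div_mul_left _ _ (pow_ne_zero 2 h2),
    mul_div_assoc]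

lemma hasDerivAt_zero_of_even {f : ℂ → ℂ} (hf : DifferentiableAt ℂ f 0)
    (he : ∀ z, f (-z) = f z) : HasDerivAt f 0 0 := by
  have h := hf.hasDerivAt
  have h1 := deriv_comp_neg f 0
  simp only [he, neg_zero] at h1
  have h2 : deriv f 0 = 0 := by linear_combination h1 / 2
  rwa [h2] at h

/-- The double poles at the origin of `θ(z + w) θ(z - w) / θ(z)²` and of `-θ(w)² ℘(z)` agree, and
since both functions are even there is no residue. -/
lemma tendsto_mul_quotient_zero (w : ℂ) :
    Tendsto (fun z => z * (theta L (z + w) * theta L (z - w) / theta L z ^ 2 +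
      theta L w ^ 2 * L.weierstrassP z)) (𝓝[≠] 0) (𝓝 0) := by
  have hdθ := differentiable_theta L
  set h : ℂ → ℂ := dslope (theta L) 0 with hh
  have hhd : Differentiable ℂ h := by
    have := (differentiableOn_dslope (c := (0 : ℂ)) (f := theta L) univ_mem).2
      hdθ.differentiableOn
    exact differentiableOn_univ.1 this
  have hθ : ∀ z, theta L z = z * h z := fun z => by
    have := sub_smul_dslope (theta L) 0 z
    rw [theta_zero, sub_zero, sub_zero, smul_eq_mul] at this
    exact this.symm
  have hh0 : h 0 = 1 := by rw [hh, dslope_same, (hasDerivAt_theta_zero L).deriv]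
  have hhe : ∀ z, h (-z) = h z := fun z => by
    by_cases hz : z = 0
    · simp [hz]
    · have h1 := hθ (-z)
      rw [theta_neg, hθ z] at h1
      exact mul_left_cancel₀ hz (by linear_combination h1)
  -- The function `z ↦ h(z)² (θ(z + w) θ(z - w) θ(z)⁻² + θ(w)² ℘(z)) z²`, continued to the origin.
  set N : ℂ → ℂ := fun z => theta L (z + w) * theta L (z - w) +
    theta L w ^ 2 * (h z ^ 2 * (1 + z ^ 2 * L.weierstrassPExcept 0 z)) with hN
  have hNd : DifferentiableAt ℂ N 0 := by
    have h1 : DifferentiableAt ℂ (L.weierstrassPExcept 0) 0 :=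
      (L.analyticAt_weierstrassPExcept 0).differentiableAt
    have h2 : DifferentiableAt ℂ h 0 := hhd 0
    have h3 : DifferentiableAt ℂ (fun z => theta L (z + w)) 0 := by fun_prop
    have h4 : DifferentiableAt ℂ (fun z => theta L (z - w)) 0 := by fun_prop
    fun_prop
  have hNe : ∀ z, N (-z) = N z := fun z => by
    have h1 := L.weierstrassPExcept_neg 0 z
    rw [neg_zero] at h1
    have h2 : theta L (-z + w) = -theta L (z - w) := by rw [← theta_neg]; ring_nf
    have h3 : theta L (-z - w) = -theta L (z + w) := by rw [← theta_neg]; ring_nf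
    simp only [hN, hhe, h1, h2, h3]
    ring
  have hN0 : N 0 = 0 := by
    simp only [hN, hh0, zero_add, zero_sub, theta_neg]
    ring
  have hN' := hasDerivAt_iff_tendsto_slope_zero.1 (hasDerivAt_zero_of_even hNd hNe)
  simp only [zero_add, hN0, sub_zero, smul_eq_mul] at hN'
  have hlim : Tendsto (fun z => (h z ^ 2)⁻¹) (𝓝[≠] 0) (𝓝 1) := by
    refine tendsto_nhdsWithin_of_tendsto_nhds ?_
    have h1 : ContinuousAt (fun z => h z ^ 2) 0 := (hhd.continuous.pow 2).continuousAt
    have := h1.fun_inv₀ (by simp [hh0])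
    simpa [ContinuousAt, hh0] using this
  have hfin := hN'.mul hlim
  rw [zero_mul] at hfin
  refine hfin.congr' ?_
  have hmem := nhdsWithin_le_nhds (s := {(0 : ℂ)}ᶜ)
    (L.compl_lattice_sdiff_singleton_mem_nhds (0 : ℂ))
  filter_upwards [hmem, self_mem_nhdsWithin] with z hz1 hz2
  have hz0 : z ≠ 0 := hz2
  have hz3 : z ∉ L.lattice := fun h => hz1 ⟨h, hz2⟩
  have hhz : h z ≠ 0 := by
    intro h1
    have := hθ z
    rw [h1, mul_zero, theta_eq_zero_iff] at this
    exact hz3 this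
  have hP : L.weierstrassP z = L.weierstrassPExcept 0 z + 1 / z ^ 2 := by
    have := L.weierstrassPExcept_add 0 z
    simpa using this.symm
  simp only [hN]
  rw [hP, hθ z]
  field_simp
  ring

/-- The expression of differences of values of `℘` in terms of theta functions: the quotient
`θ(z + w) θ(z - w) / θ(z)²` is elliptic and has the same double pole at `0` as a multiple
of `℘`. -/
lemma weierstrassP_sub_mul {z w : ℂ} (hz : z ∉ L.lattice) (hw : w ∉ L.lattice) :
    (L.weierstrassP w - L.weierstrassP z) * (normTheta L z * normTheta L w) ^ 2 =
      normTheta L (z + w) * normTheta L (z - w) := by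
  set q : ℂ → ℂ := fun z => theta L (z + w) * theta L (z - w) / theta L z ^ 2 +
    theta L w ^ 2 * L.weierstrassP z with hq
  have hdθ := differentiable_theta L
  obtain ⟨c, hc⟩ := exists_eq_const_of_norm_periodic L (q := q) (fun z hz => by
      have h1 : theta L z ^ 2 ≠ 0 := pow_ne_zero 2 fun h => hz ((theta_eq_zero_iff L).1 h)
      have h2 : DifferentiableAt ℂ L.weierstrassP z :=
        (L.analyticOnNhd_weierstrassP z hz).differentiableAt
      have h3 : Differentiable ℂ fun z => theta L (z + w) * theta L (z - w) := by fun_prop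
      have h4 : Differentiable ℂ fun z => theta L z ^ 2 := by fun_prop
      exact ((h3 z).fun_div (h4 z) h1).fun_add (h2.const_mul _)) (fun z _ γ hγ => by
      have h1 := L.weierstrassP_add_coe z ⟨γ, hγ⟩
      simp only [hq, theta_mul_theta_div, normTheta_mul_normTheta_periodic L z w hγ]
      rw [h1])
    (tendsto_mul_quotient_zero L w)
  have hcw : c = theta L w ^ 2 * L.weierstrassP w := by
    rw [← hc w hw]
    simp [hq, theta_zero]
  have h1 := hc z hz
  have hz0 : normTheta L z ≠ 0 := fun h => hz ((normTheta_eq_zero_iff L).1 h)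
  rw [hcw] at h1
  simp only [hq, theta_mul_theta_div, theta_eq_normTheta L w] at h1
  have h2 : exp (w * conj w / areaDivPi L) = exp (w * conj w / (2 * areaDivPi L)) ^ 2 := by
    have := areaDivPi_ne_zero L
    rw [← Complex.exp_nat_mul]
    congr 1
    push_cast
    field_simp
  rw [h2] at h1
  have h3 := Complex.exp_ne_zero (w * conj w / (2 * areaDivPi L))
  have h4 : exp (w * conj w / (2 * areaDivPi L)) ^ 2 *
      (normTheta L (z + w) * normTheta L (z - w) / normTheta L z ^ 2) =
      exp (w * conj w / (2 * areaDivPi L)) ^ 2 *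
        (normTheta L w ^ 2 * (L.weierstrassP w - L.weierstrassP z)) := by
    linear_combination h1
  have h5 := mul_left_cancel₀ (pow_ne_zero 2 h3) h4
  rw [div_eq_iff (pow_ne_zero 2 hz0)] at h5
  rw [h5]
  ring

lemma weierstrassP_cubic {p : ℂ} (hp : p ∉ L.lattice) (h2 : 2 * p ∈ L.lattice) :
    4 * L.weierstrassP p ^ 3 - L.g₂ * L.weierstrassP p - L.g₃ = 0 := by
  have h1 : L.derivWeierstrassP p = 0 := by
    have h3 := L.derivWeierstrassP_add_coe (-p) ⟨_, h2⟩
    simp only at h3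
    rw [show -p + 2 * p = p by ring, L.derivWeierstrassP_neg] at h3
    linear_combination h3 / 2
  rw [← L.derivWeierstrassP_sq p hp, h1]
  norm_num

lemma discr_eq_of_roots {g₂ g₃ x y z : ℂ} (hx : 4 * x ^ 3 - g₂ * x - g₃ = 0)
    (hy : 4 * y ^ 3 - g₂ * y - g₃ = 0) (hz : 4 * z ^ 3 - g₂ * z - g₃ = 0) (hxy : x ≠ y)
    (hyz : y ≠ z) (hxz : x ≠ z) :
    g₂ ^ 3 - 27 * g₃ ^ 2 = 16 * ((x - y) * (y - z) * (x - z)) ^ 2 := by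
  have h1 : g₂ = 4 * (x ^ 2 + x * y + y ^ 2) :=
    mul_left_cancel₀ (sub_ne_zero.2 hxy) (by linear_combination hy - hx)
  have h2 : g₂ = 4 * (x ^ 2 + x * z + z ^ 2) :=
    mul_left_cancel₀ (sub_ne_zero.2 hxz) (by linear_combination hz - hx)
  have h3 : z = -(x + y) :=
    mul_left_cancel₀ (sub_ne_zero.2 hyz) (by linear_combination (h2 - h1) / 4)
  have h4 : g₃ = 4 * x ^ 3 - g₂ * x := by linear_combination -hx
  rw [h4, h1, h3]
  ring

lemma normTheta_pow_congr {a b : ℂ} {n : ℕ} (ha : (n : ℂ) * a ∈ L.lattice)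
    (hab : b - a ∈ L.lattice) : normTheta L b ^ (2 * n) = normTheta L a ^ (2 * n) := by
  have := heisTheta_pow_congr L ha hab 0
  simpa [heisTheta, weil_zero_right] using this

/-- For `2`-torsion points with `s + t ≡ r`, the fourth power of `℘(s) - ℘(t)` in terms of the
values of `φ`. -/
lemma weierstrassP_sub_pow {s t r : ℂ} (hs : s ∉ L.lattice) (ht : t ∉ L.lattice)
    (hs2 : 2 * s ∈ L.lattice) (ht2 : 2 * t ∈ L.lattice) (hr : s + t - r ∈ L.lattice) :
    (L.weierstrassP s - L.weierstrassP t) ^ 4 * (normTheta L s * normTheta L t) ^ 8 =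
      normTheta L r ^ 8 := by
  have hr2 : ((2 : ℕ) : ℂ) * r ∈ L.lattice := by
    have := sub_mem (add_mem hs2 ht2) (add_mem hr hr)
    convert this using 1
    push_cast
    ring
  have h := weierstrassP_sub_mul L ht hs
  have h1 : normTheta L (t + s) ^ 4 = normTheta L r ^ 4 :=
    normTheta_pow_congr L (n := 2) hr2 (by rwa [add_comm])
  have h2 : normTheta L (t - s) ^ 4 = normTheta L r ^ 4 :=
    normTheta_pow_congr L (n := 2) hr2 (by
      have := sub_mem hr hs2
      convert this using 1
      ring)
  calc _ = ((L.weierstrassP s - L.weierstrassP t) * (normTheta L t * normTheta L s) ^ 2) ^ 4 := by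
        ring
    _ = normTheta L (t + s) ^ 4 * normTheta L (t - s) ^ 4 := by rw [h, mul_pow]
    _ = _ := by rw [h1, h2]; ring

lemma ω₁_add_ω₂_div_two_notMem : (L.ω₁ + L.ω₂) / 2 ∉ L.lattice := by
  have h := (L.mul_ω₁_add_mul_ω₂_mem_lattice (α := 1 / 2) (β := 1 / 2)).not.mpr (by norm_num)
  convert h using 2
  push_cast
  ring

/-- The discriminant in terms of the values of `φ` at the nonzero `2`-torsion points: it is sixteen
times the square of the product of the differences of the roots `℘(ω₁/2)`, `℘(ω₂/2)` and
`℘((ω₁ + ω₂)/2)` of `4x³ - g₂x - g₃`. -/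
lemma discr_sq_mul :
    discr L ^ 2 * (normTheta L (L.ω₁ / 2) * normTheta L (L.ω₂ / 2) *
      normTheta L ((L.ω₁ + L.ω₂) / 2)) ^ 8 = 2 ^ 8 := by
  have m1 := L.ω₁_mem_lattice
  have m2 := L.ω₂_mem_lattice
  have hs := L.ω₁_div_two_notMem_lattice
  have ht := L.ω₂_div_two_notMem_lattice
  have hr := ω₁_add_ω₂_div_two_notMem L
  set s := L.ω₁ / 2 with hsd
  set t := L.ω₂ / 2 with htd
  set r := (L.ω₁ + L.ω₂) / 2 with hrd
  have hs2 : 2 * s ∈ L.lattice := by convert m1 using 1; rw [hsd]; ring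
  have ht2 : 2 * t ∈ L.lattice := by convert m2 using 1; rw [htd]; ring
  have hr2 : 2 * r ∈ L.lattice := by convert add_mem m1 m2 using 1; rw [hrd]; ring
  have e1 := weierstrassP_sub_pow L hs ht hs2 ht2 (r := r) (by
    convert zero_mem L.lattice using 1; rw [hsd, htd, hrd]; ring)
  have e2 := weierstrassP_sub_pow L ht hr ht2 hr2 (r := s) (by
    convert m2 using 1; rw [hsd, htd, hrd]; ring)
  have e3 := weierstrassP_sub_pow L hs hr hs2 hr2 (r := t) (by
    convert m1 using 1; rw [hsd, htd, hrd]; ring)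
  have ns : normTheta L s ≠ 0 := fun h => hs ((normTheta_eq_zero_iff L).1 h)
  have nt : normTheta L t ≠ 0 := fun h => ht ((normTheta_eq_zero_iff L).1 h)
  have nr : normTheta L r ≠ 0 := fun h => hr ((normTheta_eq_zero_iff L).1 h)
  have ne : ∀ {x y n m : ℂ}, (x - y) ^ 4 * m ^ 8 = n ^ 8 → n ≠ 0 → x ≠ y := by
    rintro x y n m h hn rfl
    rw [sub_self, zero_pow four_ne_zero, zero_mul] at h
    exact pow_ne_zero 8 hn h.symm
  have hΔ := discr_eq_of_roots (weierstrassP_cubic L hs hs2) (weierstrassP_cubic L ht ht2)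
    (weierstrassP_cubic L hr hr2) (ne e1 nr) (ne e2 ns) (ne e3 nt)
  set D := (L.weierstrassP s - L.weierstrassP t) * (L.weierstrassP t - L.weierstrassP r) *
    (L.weierstrassP s - L.weierstrassP r) with hD
  set p := normTheta L s * normTheta L t * normTheta L r with hp
  have hp0 : p ^ 8 ≠ 0 := pow_ne_zero 8 (mul_ne_zero (mul_ne_zero ns nt) nr)
  have h1 : D ^ 4 * p ^ 8 = 1 := by
    refine mul_right_cancel₀ hp0 ?_
    calc _ = ((L.weierstrassP s - L.weierstrassP t) ^ 4 * (normTheta L s * normTheta L t) ^ 8) *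
          ((L.weierstrassP t - L.weierstrassP r) ^ 4 * (normTheta L t * normTheta L r) ^ 8) *
          ((L.weierstrassP s - L.weierstrassP r) ^ 4 * (normTheta L s * normTheta L r) ^ 8) := by
          rw [hD, hp]
          ring
      _ = 1 * p ^ 8 := by
          rw [e1, e2, e3, hp]
          ring
  rw [discr, hΔ]
  linear_combination 256 * h1

/-- The constant of the distribution relation for multiplication by `2`. Dividing the relation by
`z` and letting `z → 0` expresses it through the values of `φ` at the nonzero `2`-torsion points. -/
lemma IsDistributionConst.pow_eight_eq {κ : ℂ} (hκ : IsDistributionConst L 2 κ) :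
    κ ^ 8 = discr L ^ 2 := by
  classical
  have h2 : IsMultiplier L 2 := by simpa using isMultiplier_natCast L 2
  have := h2.finite_torsionSubgroup two_ne_zero
  have := Fintype.ofFinite (torsionSubgroup L 2)
  have hcard : Fintype.card (torsionSubgroup L 2) = 4 := by
    have := h2.card_torsionSubgroup two_ne_zero
    rw [Nat.card_eq_fintype_card] at this
    norm_num at this
    exact_mod_cast this
  have m1 := L.ω₁_mem_lattice
  have m2 := L.ω₂_mem_lattice
  have hs := L.ω₁_div_two_notMem_lattice
  have ht := L.ω₂_div_two_notMem_lattice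
  have hr := ω₁_add_ω₂_div_two_notMem L
  have hΔ := discr_sq_mul L
  set s := L.ω₁ / 2 with hsd
  set t := L.ω₂ / 2 with htd
  set r := (L.ω₁ + L.ω₂) / 2 with hrd
  have hs2 : 2 * s ∈ L.lattice := by convert m1 using 1; rw [hsd]; ring
  have ht2 : 2 * t ∈ L.lattice := by convert m2 using 1; rw [htd]; ring
  have hr2 : 2 * r ∈ L.lattice := by convert add_mem m1 m2 using 1; rw [hrd]; ring
  have h02 : (2 : ℂ) * 0 ∈ L.lattice := by simp
  set pt : ∀ x : ℂ, 2 * x ∈ L.lattice → torsionSubgroup L 2 := fun x hx =>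
    ⟨L.lattice.mkQ x, h2.mkQ_mem.2 hx⟩ with hpt
  have hne : ∀ {x y : ℂ} (hx : 2 * x ∈ L.lattice) (hy : 2 * y ∈ L.lattice), x - y ∉ L.lattice →
      pt x hx ≠ pt y hy := fun hx hy h h1 => h ((mkQ_eq_iff L).1 (congrArg Subtype.val h1))
  have n1 : pt 0 h02 ≠ pt s hs2 := hne h02 hs2 (by rwa [zero_sub, neg_mem_iff])
  have n2 : pt 0 h02 ≠ pt t ht2 := hne h02 ht2 (by rwa [zero_sub, neg_mem_iff])
  have n3 : pt 0 h02 ≠ pt r hr2 := hne h02 hr2 (by rwa [zero_sub, neg_mem_iff])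
  have n4 : pt s hs2 ≠ pt t ht2 := hne hs2 ht2 fun h => hr (by
    convert add_mem h m2 using 1; rw [hsd, htd, hrd]; ring)
  have n5 : pt s hs2 ≠ pt r hr2 := hne hs2 hr2 fun h => ht (by
    convert neg_mem h using 1; rw [hsd, htd, hrd]; ring)
  have n6 : pt t ht2 ≠ pt r hr2 := hne ht2 hr2 fun h => hs (by
    convert neg_mem h using 1; rw [hsd, htd, hrd]; ring)
  have huniv : ({pt 0 h02, pt s hs2, pt t ht2, pt r hr2} : Finset (torsionSubgroup L 2)) =
      Finset.univ := by
    refine Finset.eq_univ_of_card _ ?_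
    rw [hcard, Finset.card_insert_of_notMem (by simp [n1, n2, n3]),
      Finset.card_insert_of_notMem (by simp [n4, n5]), Finset.card_pair n6]
  have hpow : ∀ (x : ℂ) (hx : 2 * x ∈ L.lattice) (z : ℂ),
      heisTheta L (torusLift L (pt x hx)) z ^ 8 = heisTheta L x z ^ 8 := fun x hx z => by
    have := heisTheta_pow_congr L (n := 2) (a := x) (by simpa using hx)
      (torusLift_sub_mem L x) z
    have e : ∀ u : ℂ, u ^ 8 = (u ^ (2 * 2)) ^ 2 := fun u => by ring
    rw [e, e, this]
  -- The eighth power removes the dependence on the lifts, so that `torusLift` can be replaced by the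
  -- half-periods.
  have hprod : ∀ z, normTheta L (2 * z) ^ 8 = κ ^ 8 * (normTheta L z ^ 8 *
      (heisTheta L s z ^ 8 * (heisTheta L t z ^ 8 * heisTheta L r z ^ 8))) := by
    intro z
    rw [hκ.2, finprod_eq_prod_of_fintype, mul_pow, ← Finset.prod_pow, ← huniv,
      Finset.prod_insert (by simp [n1, n2, n3]), Finset.prod_insert (by simp [n4, n5]),
      Finset.prod_pair n6, hpow 0 h02, hpow s hs2, hpow t ht2, hpow r hr2]
    simp [heisTheta, weil_zero_left]
  have hcont : ∀ x : ℂ, Tendsto (fun z => heisTheta L x z ^ 8) (𝓝[≠] 0) (𝓝 (normTheta L x ^ 8)) := by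
    intro x
    refine tendsto_nhdsWithin_of_tendsto_nhds ?_
    have h1 := continuous_normTheta L
    have : Continuous fun z => heisTheta L x z ^ 8 := by
      unfold heisTheta weil
      fun_prop
    have h3 := this.tendsto 0
    simpa [heisTheta, weil_zero_right] using h3
  have hL := (tendsto_normTheta_mul_div L 2).pow 8
  have hR := ((((tendsto_normTheta_mul_div L 1).pow 8).mul
    ((hcont s).mul ((hcont t).mul (hcont r))))).const_mul (κ ^ 8)
  have heq : (2 : ℂ) ^ 8 = κ ^ 8 * (1 ^ 8 *
      (normTheta L s ^ 8 * (normTheta L t ^ 8 * normTheta L r ^ 8))) := by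
    refine tendsto_nhds_unique hL (hR.congr fun z => ?_)
    simp only [div_pow, hprod, one_mul]
    ring
  have hp0 : (normTheta L s * normTheta L t * normTheta L r) ^ 8 ≠ 0 := by
    intro h
    rw [h, mul_zero] at hΔ
    norm_num at hΔ
  refine mul_right_cancel₀ hp0 ?_
  rw [hΔ, heq]
  ring

end

/-! ### The distribution relation -/

section

variable {L : PeriodPair}

/-- The constant of the distribution relation up to roots of unity. Comparing the two orders of
composition of multiplication by `a` and by `2` expresses its third power in terms of the constant
for `2`. -/
lemma IsDistributionConst.pow_eq {a κ : ℂ} (hκ : IsDistributionConst L a κ)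
    (ha : IsMultiplier L a) (h0 : a ≠ 0) :
    κ ^ (24 * Nat.card (torsionSubgroup L a)) = discr L ^
      (2 * Nat.card (torsionSubgroup L a) * (Nat.card (torsionSubgroup L a) - 1)) := by
  have h2 : IsMultiplier L 2 := by simpa using isMultiplier_natCast L 2
  have hc2 : Nat.card (torsionSubgroup L 2) = 4 := by
    have := h2.card_torsionSubgroup two_ne_zero
    norm_num at this
    exact_mod_cast this
  obtain ⟨κ₂, hκ₂⟩ := h2.exists_isDistributionConst two_ne_zero
  obtain ⟨κ', hκ'⟩ := (ha.mul h2).exists_isDistributionConst (mul_ne_zero h0 two_ne_zero)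
  have := ha.finite_torsionSubgroup h0
  obtain ⟨m, hm⟩ := Nat.exists_eq_succ_of_ne_zero
    (Nat.card_pos (α := torsionSubgroup L a)).ne'
  set n := Nat.card (torsionSubgroup L a) with hn
  have e1 := hκ.pow_eq_mul ha h2 h0 two_ne_zero hκ₂ hκ' (M := 8 * n) (by rw [hc2]; ring)
  have e2 := hκ₂.pow_eq_mul h2 ha two_ne_zero h0 hκ (κ := κ') (by rwa [mul_comm]) (M := 8 * n)
    (by rw [hc2]; ring)
  rw [hc2] at e1
  rw [← hn] at e2
  have hne : κ ^ (8 * n) * κ₂ ^ (8 * n) ≠ 0 :=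
    mul_ne_zero (pow_ne_zero _ hκ.1) (pow_ne_zero _ hκ₂.1)
  have hsucc : ∀ x : ℂ, x ^ n = x * x ^ m := fun x => by rw [hm, Nat.succ_eq_add_one, pow_succ']
  have e3 : κ ^ (24 * n) = (κ₂ ^ (8 * n)) ^ m := by
    refine mul_left_cancel₀ hne ?_
    calc κ ^ (8 * n) * κ₂ ^ (8 * n) * κ ^ (24 * n) = κ₂ ^ (8 * n) * (κ ^ (8 * n)) ^ 4 := by ring
      _ = κ ^ (8 * n) * (κ₂ ^ (8 * n)) ^ n := by rw [← e1, e2]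
      _ = _ := by
        rw [hsucc]
        ring
  rw [e3, pow_mul, hκ₂.pow_eight_eq, hm, Nat.succ_sub_one]
  ring

lemma exp_norm_sq_mul {a : ℂ} (ha : IsMultiplier L a) (h0 : a ≠ 0) (z : ℂ) :
    exp (a * z * conj (a * z) / (2 * areaDivPi L)) =
      exp (z * conj z / (2 * areaDivPi L)) ^ Nat.card (torsionSubgroup L a) := by
  rw [← Complex.exp_nat_mul, ha.card_eq_mul_conj h0, map_mul]
  congr 1
  ring

/-- A suitable power of `θ_a` only depends on the torsion point represented by `a`. -/
lemma thetaAt_pow_congr {a b : ℂ} {n : ℕ} (ha : (n : ℂ) * a ∈ L.lattice)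
    (hab : b - a ∈ L.lattice) (z : ℂ) :
    thetaAt L b z ^ (24 * n) = thetaAt L a z ^ (24 * n) := by
  rw [thetaAt_eq, thetaAt_eq, mul_pow, mul_pow, show 24 * n = 2 * n * 12 by ring,
    pow_mul (heisTheta L b z), pow_mul (heisTheta L a z), heisTheta_pow_congr L ha hab]

/-- The distribution relation for multiplication by a complex number `a` preserving the lattice
and a point `z₀` killed by the integer `m`. -/
theorem thetaAt_mul_pow {a : ℂ} (ha : IsMultiplier L a) (h0 : a ≠ 0) {z₀ : ℂ} {m : ℕ}
    (hm : (m : ℂ) * z₀ ∈ L.lattice) [Fintype (torsionSubgroup L a)] (z : ℂ) :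
    thetaAt L (a * z₀) (a * z) ^ (24 * (Nat.card (torsionSubgroup L a) * m)) =
      discr L ^ (2 * (Nat.card (torsionSubgroup L a) * m) * (Nat.card (torsionSubgroup L a) - 1)) *
        ∏ P : torsionSubgroup L a, thetaAt L (z₀ + torusLift L P) z ^
          (24 * (Nat.card (torsionSubgroup L a) * m)) := by
  obtain ⟨κ, hκ⟩ := ha.exists_isDistributionConst h0
  have hpow := hκ.pow_eq ha h0
  set n := Nat.card (torsionSubgroup L a) with hn
  have hw : ∀ P : torsionSubgroup L a, weil L (torusLift L P) z₀ ^ (24 * (n * m)) = 1 := by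
    intro P
    have h1 : (m : ℂ) * (a * z₀) ∈ L.lattice := by
      rw [mul_left_comm]
      exact ha _ hm
    rw [show 24 * (n * m) = 2 * (n * m) * 12 by ring, pow_mul,
      ha.weil_pow_eq_one h0 (ha.mul_torusLift_mem P) h1, one_pow]
  have hκm : κ ^ (24 * (n * m)) = discr L ^ (2 * (n * m) * (n - 1)) := by
    rw [show 24 * (n * m) = 24 * n * m by ring, pow_mul, hpow, ← pow_mul]
    congr 1
    ring
  have he : (∏ _P : torsionSubgroup L a, exp (z * conj z / (2 * areaDivPi L)) ^ (24 * (n * m))) =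
      (exp (z * conj z / (2 * areaDivPi L)) ^ n) ^ (24 * (n * m)) := by
    rw [Finset.prod_const, Finset.card_univ, ← Nat.card_eq_fintype_card, ← hn, ← pow_mul, ← pow_mul,
      mul_comm n (24 * (n * m))]
  simp only [thetaAt_eq, mul_pow]
  rw [exp_norm_sq_mul ha h0, ← hn, hκ.heisTheta_mul ha h0, Finset.prod_mul_distrib,
    Finset.prod_mul_distrib, he, mul_pow, mul_pow, hκm, ← Finset.prod_pow, ← Finset.prod_pow]
  simp only [hw, Finset.prod_const_one]
  ring

end

section

lemma HasCM.isMultiplier {K : Type*} [Field K] {ι : K →+* ℂ} {L : PeriodPair} (h : HasCM ι L) (α : 𝓞 K) :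
    IsMultiplier L (ι (α : K)) := h α

variable {K : Type*} [Field K] [NumberField K]

/-- In an imaginary quadratic field, the norm of a principal ideal is the square of the absolute
value of a generator. -/
lemma absNorm_span_singleton_eq [Algebra.IsQuadraticExtension ℚ K] [NumberField.IsTotallyComplex K]
    (ι : K →+* ℂ) (α : 𝓞 K) :
    (Ideal.absNorm (Ideal.span {α}) : ℝ) = ‖ι (α : K)‖ ^ 2 := by
  classical
  have hcard : Fintype.card (NumberField.InfinitePlace K) = 1 := by
    have h1 := NumberField.InfinitePlace.card_add_two_mul_card_eq_rank K
    have h2 := NumberField.InfinitePlace.card_eq_nrRealPlaces_add_nrComplexPlaces K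
    have h3 : Module.finrank ℚ K = 2 := Algebra.IsQuadraticExtension.finrank_eq_two ℚ K
    have h4 : NumberField.InfinitePlace.nrRealPlaces K = 0 :=
      NumberField.IsTotallyComplex.nrRealPlaces_eq_zero K
    omega
  have := Fintype.card_le_one_iff_subsingleton.1 hcard.le
  have h := NumberField.InfinitePlace.prod_eq_abs_norm (α : K)
  rw [Fintype.prod_subsingleton _ (NumberField.InfinitePlace.mk ι),
    NumberField.InfinitePlace.mult, if_neg (NumberField.InfinitePlace.not_isReal_iff_isComplex.2
      (NumberField.IsTotallyComplex.isComplex _)), NumberField.InfinitePlace.apply] at h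
  rw [h, Ideal.absNorm_span_singleton, ← Algebra.coe_norm_int, Nat.cast_natAbs]
  push_cast
  rfl

lemma card_torsionSubgroup_eq_absNorm [Algebra.IsQuadraticExtension ℚ K]
    [NumberField.IsTotallyComplex K] {ι : K →+* ℂ} {L : PeriodPair} (h : HasCM ι L) {α : 𝓞 K}
    (hα : ι (α : K) ≠ 0) :
    Nat.card (torsionSubgroup L (ι (α : K))) = Ideal.absNorm (Ideal.span {α}) := by
  have h1 := (h.isMultiplier α).card_torsionSubgroup hα
  rw [← absNorm_span_singleton_eq] at h1
  exact_mod_cast h1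

lemma IsIdealTorsion.absNorm_mul_mem {ι : K →+* ℂ} {L : PeriodPair} {𝔣 : Ideal (𝓞 K)} {z₀ : ℂ}
    (h : IsIdealTorsion ι L 𝔣 z₀) : (Ideal.absNorm 𝔣 : ℂ) * z₀ ∈ L.lattice := by
  simpa using h _ (Ideal.absNorm_mem 𝔣)

/-- The product does not depend on the representative `z₁` of the torsion point of `z₀`, nor on the
choice of the lifts: it equals the one formed with `z₀` and `torusLift`. -/
lemma distributionProduct_eq [Algebra.IsQuadraticExtension ℚ K]
    [NumberField.IsTotallyComplex K] {ι : K →+* ℂ} {L : PeriodPair} (hCM : HasCM ι L)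
    {𝔣 : Ideal (𝓞 K)} {α : 𝓞 K} (hα : ι (α : K) ≠ 0) {z₀ : ℂ} (hz₀ : IsIdealTorsion ι L 𝔣 z₀)
    {z₁ : ℂ} (hz₁ : z₁ - z₀ ∈ L.lattice) {l : Torus L → ℂ}
    (hl : IsLiftOfTorsion L (ι (α : K)) l) [Fintype (torsionSubgroup L (ι (α : K)))] (z : ℂ) :
    distributionProduct ι L 𝔣 α z₁ l z =
      discr L ^ (2 * (Ideal.absNorm (Ideal.span {α}) * Ideal.absNorm 𝔣) *
        (Ideal.absNorm (Ideal.span {α}) - 1)) *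
      ∏ P : torsionSubgroup L (ι (α : K)), thetaAt L (z₀ + torusLift L P) z ^
        (24 * (Ideal.absNorm (Ideal.span {α}) * Ideal.absNorm 𝔣)) := by
  have ha := hCM.isMultiplier α
  rw [distributionProduct, map_mul, ← coe_torsionSubgroup]
  congr 1
  rw [← finprod_set_coe_eq_finprod_mem]
  refine (finprod_eq_prod_of_fintype _).trans (Finset.prod_congr rfl fun P _ => ?_)
  have hP : (P : Torus L) ∈ torsionPoints L (ι (α : K)) := by
    rw [← coe_torsionSubgroup]
    exact P.2
  refine thetaAt_pow_congr ?_ ?_ z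
  · have h1 := ha.card_mul_mem (ha.mul_torusLift_mem P)
    rw [card_torsionSubgroup_eq_absNorm hCM hα] at h1
    have h2 := natCast_mul_mem L (Ideal.absNorm (Ideal.span {α})) hz₀.absNorm_mul_mem
    have h3 := natCast_mul_mem L (Ideal.absNorm 𝔣) h1
    convert add_mem h2 h3 using 1
    push_cast
    ring
  · have h1 : l P - torusLift L P ∈ L.lattice := by
      rw [← mkQ_eq_iff, mkQ_torusLift]
      exact hl P hP
    convert add_mem hz₁ h1 using 1
    ring

end

end KroneckerTheta

end

theorem mainTheorem4 {K : Type*} [Field K] [NumberField K] [Algebra.IsQuadraticExtension ℚ K]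
    [NumberField.IsTotallyComplex K] (ι : K →+* ℂ) (L : PeriodPair)
    (hCM : KroneckerTheta.HasCM ι L) (𝔣 : Ideal (𝓞 K)) (h𝔣 : 𝔣 ≠ ⊥) (α : 𝓞 K) (hα : α ≠ 0)
    (z₀ : ℂ) (hz₀ : KroneckerTheta.IsIdealTorsion ι L 𝔣 z₀) :
    (KroneckerTheta.torsionPoints L (ι (α : K))).Finite ∧
    (∀ ℓ : KroneckerTheta.Torus L → ℂ, KroneckerTheta.IsLiftOfTorsion L (ι (α : K)) ℓ →
      ∀ z : ℂ,
        KroneckerTheta.thetaAt L (ι (α : K) * z₀) (ι (α : K) * z) ^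
            (24 * Ideal.absNorm (Ideal.span {α} * 𝔣)) =
          KroneckerTheta.distributionProduct ι L 𝔣 α z₀ ℓ z) ∧
    (∀ z₀' : ℂ, z₀' - z₀ ∈ L.lattice →
      ∀ ℓ ℓ' : KroneckerTheta.Torus L → ℂ,
        KroneckerTheta.IsLiftOfTorsion L (ι (α : K)) ℓ →
        KroneckerTheta.IsLiftOfTorsion L (ι (α : K)) ℓ' →
        ∀ z : ℂ,
          KroneckerTheta.distributionProduct ι L 𝔣 α z₀ ℓ z =
            KroneckerTheta.distributionProduct ι L 𝔣 α z₀' ℓ' z) := by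
  classical
  have ha := hCM.isMultiplier α
  have h0 : ι (α : K) ≠ 0 := by simpa using hα
  have hfin := ha.finite_torsionSubgroup h0
  have := Fintype.ofFinite (KroneckerTheta.torsionSubgroup L (ι (α : K)))
  have hcard := KroneckerTheta.card_torsionSubgroup_eq_absNorm hCM h0
  refine ⟨?_, fun ℓ hℓ z => ?_, fun z₀' hz₀' ℓ ℓ' hℓ hℓ' z => ?_⟩
  · rw [← KroneckerTheta.coe_torsionSubgroup]
    exact Set.toFinite _
  · have h := KroneckerTheta.thetaAt_mul_pow ha h0 hz₀.absNorm_mul_mem z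
    rw [hcard] at h
    rw [KroneckerTheta.distributionProduct_eq hCM h0 hz₀ (by simp) hℓ, map_mul, h]
  · rw [KroneckerTheta.distributionProduct_eq hCM h0 hz₀ (by simp) hℓ,
      KroneckerTheta.distributionProduct_eq hCM h0 hz₀ hz₀' hℓ']
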